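/- **Setting.** Let $n\in\{2,3\}$, let $\Omega\subset\mathbb R^n$ be a bounded convex open set, and let $Ly=-\sum_{i,j}\partial_{x_j}(a_{ij}\,\partial_{x_i}y)+c\,y$ with $a_{ij}=a_{ji},\,c\in L^\infty(\Omega)$, $c\ge 0$, be uniformly elliptic on $\Omega$, with bilinear form $a(y,v)=\int_\Omega\big(\sum_{i,j}a_{ij}\,\partial_{x_i}y\,\partial_{x_j}v+c\,yv\big)dx$. Let $\mathcal T_h$ be a finite conforming triangulation by $n$-simplices, let $\Omega_h\subseteq\Omega$ be the interior of the union of its cells, let $x_1,\dots,x_N$ be its vertices lying in $\Omega_h$, and let $\phi_1,\dots,\phi_N$ be the corresponding continuous piecewise linear nodal basis functions (zero outside $\Omega_h$). Put $$M=\Big(\int_{\Omega_h}\phi_i\phi_j\,dx\Big)_{ij},\qquad K=\big(a(\phi_i,\phi_j)\big)_{ij},\qquad W=\mathrm{diag}\Big(\int_{\Omega_h}\phi_i\,dx\Big)_i ,$$ and $c_n=4$ if $n=2$, $c_n=5$ if $n=3$. Write $\|x\|_A^2=\langle x,Ax\rangle$. Let $\alpha,\beta>0$, $a\le 0\le b$,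 and let $y_d,y_r\in\mathbb R^N$ be the coefficient vectors of the $L^2$-projections of two given functions in $L^2(\Omega)$ onto $\mathrm{span}\{\phi_i\}$. For $z=(\mu,\lambda,p)\in(\mathbb R^N)^3$ let $$\Phi_h(z)=\tfrac12\|Kp-My_d\|_{M^{-1}}^2+\tfrac1{2\alpha}\|\lambda+\mu-p\|_M^2+\langle My_r,p\rangle+\delta_{[-\beta,\beta]}(\lambda)+\delta^*_{[a,b]}(M\mu)-\tfrac12\|y_d\|_M^2,$$ where $\delta_{[-\beta,\beta]}$ is the indicator function ($0$ or $+\infty$) of $[-\beta,\beta]^N$ and $\delta^*_{[a,b]}(\xi)=\sup_{u\in[a,b]^N}\langle u,\xi\rangle$. Let $$D_1=\tfrac1\alpha\big(c_nMW^{-1}M-M\big),\quad Q_{22}=\tfrac1\alpha\begin{pmatrix}M&-M\\-M&M+\alpha KM^{-1}K\end{pmatrix},\quad D_2=\mathrm{sGS}(Q_{22})+\tfrac1\alpha\begin{pmatrix}W-M&0\\0&0\end{pmatrix},$$ where $\mathrm{sGS}(H)=UD^{-1}U^{T}$ for a symmetric two-block matrix $H=D+U+U^{T}$ with block diagonal part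 $D$ and strictly upper block triangular part $U$; and let $S=\mathrm{Diag}(D_1,\;D_2+Q_{22})$. **Algorithm (sGS-imABCD).** Given tolerances $\varepsilon_k\ge0$ ($k\ge 1$), start from $z^1=\tilde z^0=(\tilde\mu^0,\tilde\lambda^0,\tilde p^0)\in\mathbb R^N\times[-\beta,\beta]^N\times\mathbb R^N$ and $t_1=1$. For $k=1,2,\dots$, with arbitrary error vectors satisfying $\max\{\|\delta_\mu^k\|,\|\hat\delta_p^k\|,\|\delta_p^k\|\}\le\varepsilon_k$ (Euclidean norm), compute $$\begin{aligned} \tilde\mu^k&=\arg\min_\mu\ \tfrac1{2\alpha}\|\mu-(p^k-\lambda^k)\|_M^2+\delta^*_{[a,b]}(M\mu)+\tfrac12\|\mu-\mu^k\|_{D_1}^2-\langle\delta_\mu^k,\mu\rangle,\\ \hat p^k&=\arg\min_p\ \tfrac12\|Kp-My_d\|_{M^{-1}}^2+\tfrac1{2\alpha}\|p-\lambda^k-\tilde\mu^k+\alpha y_r\|_M^2-\langle\hat\delta_p^k,p\rangle,\\ \tilde\lambda^k&=\arg\min_\lambda\ \tfrac1{2\alpha}\|\lambda-(\hat p^k-\tilde\mu^k)\|_M^2+\delta_{[-\beta,\beta]}(\lambda)+\tfrac1{2\alpha}\|\lambda-\lambda^k\|_{W-M}^2,\\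 \tilde p^k&=\arg\min_p\ \tfrac12\|Kp-My_d\|_{M^{-1}}^2+\tfrac1{2\alpha}\|p-\tilde\lambda^k-\tilde\mu^k+\alpha y_r\|_M^2-\langle\delta_p^k,p\rangle, \end{aligned}$$ and set $t_{k+1}=\frac{1+\sqrt{1+4t_k^2}}2$, $z^{k+1}=\tilde z^k+\frac{t_k-1}{t_{k+1}}(\tilde z^k-\tilde z^{k-1})$, where $z^k=(\mu^k,\lambda^k,p^k)$ and $\tilde z^k=(\tilde\mu^k,\tilde\lambda^k,\tilde p^k)$. **Theorem.** Assume $\sum_{k\ge1}k\,\varepsilon_k<\infty$. For every $R\in\mathbb R$ there is a constant $c_0\ge0$, depending only on $\Omega$, $L$, $\mathcal T_h$, $\alpha$, $(\varepsilon_k)$ and $R$, such that for all $\beta,a,b$ and $y_d,y_r$ as above, every minimizer $z^*$ of $\Phi_h$ over $(\mathbb R^N)^3$, and every sequence $(\tilde z^k)$ generated by the algorithm with $\|\tilde z^0-z^*\|_S^2\le R$, $$\Phi_h(\tilde z^k)-\Phi_h(z^*)\le\frac{2\|\tilde z^0-z^*\|_S^2+c_0}{(k+1)^2}\qquad\text{for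 all }k\ge1 .$$ -/

import Mathlib

open MeasureTheory Matrix

noncomputable section

/-! ### Finite element discretization -/

/-- `w` is a system of barycentric weights of the point `x` in the simplicial complex `K`: the
weights live on the vertices of one face of `K`, are nonnegative, sum to one, and average the
vertices to `x`. -/
def IsBarycentricWeight {n : ℕ} (K : Geometry.SimplicialComplex ℝ (EuclideanSpace ℝ (Fin n)))
    (x : EuclideanSpace ℝ (Fin n)) (w : EuclideanSpace ℝ (Fin n) → ℝ) : Prop :=
  ∃ s ∈ K.faces, (∀ y ∈ s, 0 ≤ w y) ∧ (∀ y, y ∉ s → w y = 0) ∧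
    ∑ y ∈ s, w y = 1 ∧ ∑ y ∈ s, w y • y = x

open Classical in
/-- The piecewise linear nodal ("hat") function of the vertex `v`: at a point of the complex it is
the barycentric coordinate of that point with respect to `v` (see `hat_eq`), and it is zero outside
the complex. -/
def hat {n : ℕ} (K : Geometry.SimplicialComplex ℝ (EuclideanSpace ℝ (Fin n)))
    (v x : EuclideanSpace ℝ (Fin n)) : ℝ :=
  if h : ∃ w, IsBarycentricWeight K x w then h.choose v else 0

/-- Barycentric weights are unique, so that `hat` does not depend on any choice. -/
theorem IsBarycentricWeight.unique {n : ℕ}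
    {K : Geometry.SimplicialComplex ℝ (EuclideanSpace ℝ (Fin n))} {x : EuclideanSpace ℝ (Fin n)}
    {w w' : EuclideanSpace ℝ (Fin n) → ℝ} (h : IsBarycentricWeight K x w)
    (h' : IsBarycentricWeight K x w') : w = w' := by
  classical
  obtain ⟨s, hs, hs0, hsz, hs1, hsx⟩ := h
  obtain ⟨t, ht, ht0, htz, ht1, htx⟩ := h'
  have hx : x ∈ convexHull ℝ ((s ∩ t : Finset _) : Set (EuclideanSpace ℝ (Fin n))) := by
    rw [Finset.coe_inter]
    refine K.inter_subset_convexHull hs ht ⟨?_, ?_⟩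
    · exact Finset.mem_convexHull'.2 ⟨w, hs0, hs1, hsx⟩
    · exact Finset.mem_convexHull'.2 ⟨w', ht0, ht1, htx⟩
  obtain ⟨u, -, hu1, hux⟩ := Finset.mem_convexHull'.1 hx
  have key : ∀ (r : Finset (EuclideanSpace ℝ (Fin n))) (v : EuclideanSpace ℝ (Fin n) → ℝ),
      r ∈ K.faces → s ∩ t ⊆ r → (∀ y, y ∉ r → v y = 0) → ∑ y ∈ r, v y = 1 →
      ∑ y ∈ r, v y • y = x → ∀ y, v y = if y ∈ s ∩ t then u y else 0 := by
    intro r v hr hsub hvz hv1 hvx y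
    by_cases hy : y ∈ r
    · have e1 : ∑ y ∈ r, (v y - if y ∈ s ∩ t then u y else 0) = 0 := by
        rw [Finset.sum_sub_distrib, hv1, Finset.sum_ite_mem,
          Finset.inter_eq_right.2 hsub, hu1, sub_self]
      have e2 : ∑ y ∈ r, (v y - if y ∈ s ∩ t then u y else 0) • y = 0 := by
        simp only [sub_smul, ite_smul, zero_smul]
        rw [Finset.sum_sub_distrib, hvx, Finset.sum_ite_mem,
          Finset.inter_eq_right.2 hsub, hux, sub_self]
      have hi := affineIndependent_iff.1 (K.indep hr) Finset.univ
        (fun y => v y - if (y : EuclideanSpace ℝ (Fin n)) ∈ s ∩ t then u y else 0)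
        ((Finset.sum_coe_sort r (fun y => v y - if y ∈ s ∩ t then u y else 0)).trans e1)
        ((Finset.sum_coe_sort r
          (fun y => (v y - if y ∈ s ∩ t then u y else 0) • y)).trans e2)
        ⟨y, hy⟩ (Finset.mem_univ _)
      exact sub_eq_zero.1 hi
    · rw [hvz y hy, if_neg fun hm => hy (hsub hm)]
  funext y
  rw [key s w hs Finset.inter_subset_left hsz hs1 hsx y,
    key t w' ht Finset.inter_subset_right htz ht1 htx y]

theorem hat_eq {n : ℕ} {K : Geometry.SimplicialComplex ℝ (EuclideanSpace ℝ (Fin n))}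
    {x : EuclideanSpace ℝ (Fin n)} {w : EuclideanSpace ℝ (Fin n) → ℝ}
    (h : IsBarycentricWeight K x w) (v : EuclideanSpace ℝ (Fin n)) : hat K v x = w v := by
  have hex : ∃ w, IsBarycentricWeight K x w := ⟨w, h⟩
  rw [hat, dif_pos hex, hex.choose_spec.unique h]

/-- A conforming triangulation: finitely many nondegenerate closed `n`-simplices (triangles for
`n = 2`, tetrahedra for `n = 3`), any two of which meet in a common face, together with an
enumeration of the interior vertices.  The interior vertices are the nodes which carry the degrees
of freedom under the homogeneous Dirichlet condition. -/
structure Triangulation (n : ℕ) where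
  /-- all simplices of the triangulation with all their faces -/
  complex : Geometry.SimplicialComplex ℝ (EuclideanSpace ℝ (Fin n))
  finite_faces : complex.faces.Finite
  /-- every face is a face of an `n`-dimensional cell -/
  pure_dim : ∀ s ∈ complex.faces, ∃ t ∈ complex.faces, s ⊆ t ∧ t.card = n + 1
  /-- the number of interior nodes -/
  N : ℕ
  /-- the interior nodes -/
  node : Fin N → EuclideanSpace ℝ (Fin n)
  node_injective : Function.Injective node
  range_node : Set.range node = complex.vertices ∩ interior complex.space

namespace Triangulation

variable {n : ℕ} (T : Triangulation n)

/-- The discretized domain, the interior of the union of all cells. -/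
def domain : Set (EuclideanSpace ℝ (Fin n)) := interior T.complex.space

/-- The nodal basis function of the `i`-th interior node. -/
def basisFun (i : Fin T.N) (x : EuclideanSpace ℝ (Fin n)) : ℝ := hat T.complex (T.node i) x

/-- The finite element function with coefficient vector `c`. -/
def feFun (c : Fin T.N → ℝ) (x : EuclideanSpace ℝ (Fin n)) : ℝ := ∑ i, c i * T.basisFun i x

/-- The partial derivative `∂ φᵢ / ∂ xₖ`; it exists in the interior of each cell, hence almost
everywhere. -/
def basisDeriv (i : Fin T.N) (k : Fin n) (x : EuclideanSpace ℝ (Fin n)) : ℝ :=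
  fderiv ℝ (T.basisFun i) x (EuclideanSpace.single k 1)

/-- The mass matrix. -/
def mass : Matrix (Fin T.N) (Fin T.N) ℝ :=
  Matrix.of fun i j => ∫ x in T.domain, T.basisFun i x * T.basisFun j x

/-- The lumped mass matrix. -/
def lumpedMass : Matrix (Fin T.N) (Fin T.N) ℝ :=
  Matrix.diagonal fun i => ∫ x in T.domain, T.basisFun i x

/-- The stiffness matrix `(a(φᵢ, φⱼ))ᵢⱼ` of the bilinear form
`a(y, v) = ∫_Ω (∑ₖₗ Aₗₖ ∂ₖy ∂ₗv + c y v) dx`. -/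
def stiffness (Ω : Set (EuclideanSpace ℝ (Fin n)))
    (A : EuclideanSpace ℝ (Fin n) → Matrix (Fin n) (Fin n) ℝ) (c : EuclideanSpace ℝ (Fin n) → ℝ) :
    Matrix (Fin T.N) (Fin T.N) ℝ :=
  Matrix.of fun i j => ∫ x in Ω,
    ((∑ k, ∑ l, A x l k * T.basisDeriv i k x * T.basisDeriv j l x)
      + c x * T.basisFun i x * T.basisFun j x)

/-- `y` is the coefficient vector of the `L²(Ω)`-projection of `f` onto the finite element space,
i.e. of the best approximation of `f` in that space. -/
def IsL2Projection (Ω : Set (EuclideanSpace ℝ (Fin n))) (f : EuclideanSpace ℝ (Fin n) → ℝ)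
    (y : Fin T.N → ℝ) : Prop :=
  ∀ c : Fin T.N → ℝ,
    ∫ x in Ω, (f x - T.feFun y x) ^ 2 ≤ ∫ x in Ω, (f x - T.feFun c x) ^ 2

end Triangulation

/-- The standing assumption on the operator `L y = -∑ ∂ⱼ(Aᵢⱼ ∂ᵢ y) + c y` on `Ω`: essentially
bounded coefficients, `c ≥ 0`, symmetry, and uniform ellipticity. -/
structure IsUniformlyElliptic {n : ℕ} (Ω : Set (EuclideanSpace ℝ (Fin n)))
    (A : EuclideanSpace ℝ (Fin n) → Matrix (Fin n) (Fin n) ℝ)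
    (c : EuclideanSpace ℝ (Fin n) → ℝ) : Prop where
  memLp_A : ∀ i j, MemLp (fun x => A x i j) ⊤ (volume.restrict Ω)
  memLp_c : MemLp c ⊤ (volume.restrict Ω)
  c_nonneg : ∀ᵐ x ∂(volume.restrict Ω), 0 ≤ c x
  symm : ∀ᵐ x ∂(volume.restrict Ω), ∀ i j, A x i j = A x j i
  elliptic : ∃ θ > 0, ∀ᵐ x ∂(volume.restrict Ω), ∀ ξ : EuclideanSpace ℝ (Fin n),
    θ * ‖ξ‖ ^ 2 ≤ ∑ i, ∑ j, A x i j * ξ i * ξ j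

/-! ### The discretized dual problem -/

/-- The squared (semi)norm `‖x‖_A² = ⟨x, A x⟩`. -/
def normSqM {ι : Type*} [Fintype ι] (A : Matrix ι ι ℝ) (x : ι → ℝ) : ℝ := x ⬝ᵥ (A *ᵥ x)

/-- The operator `sGS(H) = U D⁻¹ Uᵀ` of a symmetric two-block matrix `H = D + U + Uᵀ`, with `D` the
block diagonal and `U` the strictly upper block triangular part. -/
def sGS {ι : Type*} [Fintype ι] [DecidableEq ι] (H : Matrix (ι ⊕ ι) (ι ⊕ ι) ℝ) :
    Matrix (ι ⊕ ι) (ι ⊕ ι) ℝ :=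
  fromBlocks 0 H.toBlocks₁₂ 0 0 * (fromBlocks H.toBlocks₁₁ 0 0 H.toBlocks₂₂)⁻¹
    * (fromBlocks 0 H.toBlocks₁₂ 0 0)ᵀ

/-- The support function `δ*_{[a,b]}(ξ) = sup {⟨u, ξ⟩ : a ≤ uᵢ ≤ b for all i}`. -/
def supportFun {N : ℕ} (a b : ℝ) (ξ : Fin N → ℝ) : ℝ :=
  sSup ((fun u : Fin N → ℝ => u ⬝ᵥ ξ) '' {u | ∀ i, a ≤ u i ∧ u i ≤ b})

open Classical in
/-- The indicator function `δ_{[-β,β]}` of the box `[-β,β]^N`. -/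
def boxIndicator {N : ℕ} (β : ℝ) (v : Fin N → ℝ) : EReal :=
  if ∀ i, -β ≤ v i ∧ v i ≤ β then 0 else ⊤

/-- `x` is a minimizer of `F`. -/
def IsArgmin {X R : Type*} [LE R] (F : X → R) (x : X) : Prop := ∀ y, F x ≤ F y

/-- A point `z = (μ, λ, p)`. -/
@[ext] structure DualVar (N : ℕ) where
  mu : Fin N → ℝ
  lam : Fin N → ℝ
  p : Fin N → ℝ

/-- The data of the discretized dual problem: mass matrix `M`, stiffness matrix `K`, lumped mass
matrix `W`, the constant `cn`, the parameters `α, β, a, b`, and the coefficient vectors of the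
desired state and of the source. -/
structure DualData (N : ℕ) where
  M : Matrix (Fin N) (Fin N) ℝ
  K : Matrix (Fin N) (Fin N) ℝ
  W : Matrix (Fin N) (Fin N) ℝ
  cn : ℝ
  α : ℝ
  β : ℝ
  a : ℝ
  b : ℝ
  yd : Fin N → ℝ
  yr : Fin N → ℝ

namespace DualData

variable {N : ℕ} (D : DualData N)

/-- The smooth part `φ(μ, λ, p)` of the dual objective. -/
def smooth (z : DualVar N) : ℝ :=
  1 / 2 * normSqM D.M⁻¹ (D.K *ᵥ z.p - D.M *ᵥ D.yd)
    + 1 / (2 * D.α) * normSqM D.M (z.lam + z.mu - z.p)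
    + (D.M *ᵥ D.yr) ⬝ᵥ z.p - 1 / 2 * normSqM D.M D.yd

/-- The objective `Φ_h` of the discretized dual problem. -/
def Phi (z : DualVar N) : EReal :=
  ((D.smooth z + supportFun D.a D.b (D.M *ᵥ z.mu) : ℝ) : EReal) + boxIndicator D.β z.lam

/-- `z` is an optimal solution of the discretized dual problem. -/
def IsSolution (z : DualVar N) : Prop := IsArgmin D.Phi z

/-- `D₁ = (1/α) (cₙ M W⁻¹ M - M)`. -/
def D1 : Matrix (Fin N) (Fin N) ℝ :=
  (1 / D.α) • (D.cn • (D.M * D.W⁻¹ * D.M)) - (1 / D.α) • D.M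

/-- The `(λ, p)`-block `Q₂₂` of the Hessian of `φ`. -/
def Q22 : Matrix (Fin N ⊕ Fin N) (Fin N ⊕ Fin N) ℝ :=
  (1 / D.α) • fromBlocks D.M (-D.M) (-D.M) (D.M + D.α • (D.K * D.M⁻¹ * D.K))

/-- `D₂ = sGS(Q₂₂) + (1/α) Diag(W - M, 0)`. -/
def D2 : Matrix (Fin N ⊕ Fin N) (Fin N ⊕ Fin N) ℝ :=
  sGS D.Q22 + (1 / D.α) • fromBlocks (D.W - D.M) 0 0 0

/-- `S = Diag(D₁, D₂ + Q₂₂)`. -/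
def S : Matrix (Fin N ⊕ (Fin N ⊕ Fin N)) (Fin N ⊕ (Fin N ⊕ Fin N)) ℝ :=
  fromBlocks D.D1 0 0 (D.D2 + D.Q22)

/-- `‖z - z'‖_S²`. -/
def distSqS (z z' : DualVar N) : ℝ :=
  normSqM D.S (Sum.elim (z.mu - z'.mu) (Sum.elim (z.lam - z'.lam) (z.p - z'.p)))

/-- The objective of the `μ`-subproblem at the extrapolated point `zk` with error vector `δ`. -/
def muObj (zk : DualVar N) (δ : Fin N → ℝ) (mu : Fin N → ℝ) : ℝ :=
  1 / (2 * D.α) * normSqM D.M (mu - (zk.p - zk.lam)) + supportFun D.a D.b (D.M *ᵥ mu)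
    + 1 / 2 * normSqM D.D1 (mu - zk.mu) - δ ⬝ᵥ mu

/-- The objective of the `p`-subproblems, for given `μ`, `λ` and error vector `δ`. -/
def pObj (mu lam δ : Fin N → ℝ) (p : Fin N → ℝ) : ℝ :=
  1 / 2 * normSqM D.M⁻¹ (D.K *ᵥ p - D.M *ᵥ D.yd)
    + 1 / (2 * D.α) * normSqM D.M (p - lam - mu + D.α • D.yr) - δ ⬝ᵥ p

/-- The objective of the `λ`-subproblem, for given `μ`, `p̂` and extrapolated `λᵏ`. -/
def lamObj (mu phat lamk : Fin N → ℝ) (lam : Fin N → ℝ) : EReal :=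
  ((1 / (2 * D.α) * normSqM D.M (lam - (phat - mu))
    + 1 / (2 * D.α) * normSqM (D.W - D.M) (lam - lamk) : ℝ) : EReal) + boxIndicator D.β lam

/-- A run of the sGS-imABCD algorithm with error tolerances `ε 1, ε 2, …`.  The iterates are
`zt k` (`k ≥ 0`), the extrapolated points are `z k` (`k ≥ 1`); the values at `k = 0` of the other
sequences play no role.  The initial `μ` is unrestricted because the support function of a bounded
box is finite everywhere. -/
structure Run (ε : ℕ → ℝ) where
  zt : ℕ → DualVar N
  z : ℕ → DualVar N
  phat : ℕ → Fin N → ℝ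
  t : ℕ → ℝ
  /-- error vector of the `μ`-subproblem -/
  δμ : ℕ → Fin N → ℝ
  /-- error vector of the first `p`-subproblem -/
  δphat : ℕ → Fin N → ℝ
  /-- error vector of the second `p`-subproblem -/
  δp : ℕ → Fin N → ℝ
  /-- input -/
  init_mem : ∀ i, -D.β ≤ (zt 0).lam i ∧ (zt 0).lam i ≤ D.β
  z_one : z 1 = zt 0
  t_one : t 1 = 1
  /-- the error vectors are within the tolerances, in the Euclidean norm -/
  norm_δμ : ∀ k, 1 ≤ k → ‖WithLp.toLp 2 (δμ k)‖ ≤ ε k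
  norm_δphat : ∀ k, 1 ≤ k → ‖WithLp.toLp 2 (δphat k)‖ ≤ ε k
  norm_δp : ∀ k, 1 ≤ k → ‖WithLp.toLp 2 (δp k)‖ ≤ ε k
  /-- Step 1: `μ`, first `p`, `λ`, and second `p` subproblem -/
  mu_step : ∀ k, 1 ≤ k → IsArgmin (D.muObj (z k) (δμ k)) (zt k).mu
  phat_step : ∀ k, 1 ≤ k → IsArgmin (D.pObj (zt k).mu (z k).lam (δphat k)) (phat k)
  lam_step : ∀ k, 1 ≤ k → IsArgmin (D.lamObj (zt k).mu (phat k) (z k).lam) (zt k).lam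
  p_step : ∀ k, 1 ≤ k → IsArgmin (D.pObj (zt k).mu (zt k).lam (δp k)) (zt k).p
  /-- Step 2: extrapolation with `β_k = (t_k - 1) / t_{k+1}` -/
  t_succ : ∀ k, 1 ≤ k → t (k + 1) = (1 + Real.sqrt (1 + 4 * t k ^ 2)) / 2
  mu_succ : ∀ k, 1 ≤ k → (z (k + 1)).mu
    = (zt k).mu + ((t k - 1) / t (k + 1)) • ((zt k).mu - (zt (k - 1)).mu)
  lam_succ : ∀ k, 1 ≤ k → (z (k + 1)).lam
    = (zt k).lam + ((t k - 1) / t (k + 1)) • ((zt k).lam - (zt (k - 1)).lam)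
  p_succ : ∀ k, 1 ≤ k → (z (k + 1)).p
    = (zt k).p + ((t k - 1) / t (k + 1)) • ((zt k).p - (zt (k - 1)).p)

end DualData

/-- The discretized dual problem of the `L¹`-control problem on the triangulation `T`, with
`cₙ = 4` if `n = 2` and `cₙ = 5` if `n = 3`. -/
def Triangulation.dualData {n : ℕ} (T : Triangulation n) (Ω : Set (EuclideanSpace ℝ (Fin n)))
    (A : EuclideanSpace ℝ (Fin n) → Matrix (Fin n) (Fin n) ℝ) (c : EuclideanSpace ℝ (Fin n) → ℝ)
    (α β a b : ℝ) (yd yr : Fin T.N → ℝ) : DualData T.N where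
  M := T.mass
  K := T.stiffness Ω A c
  W := T.lumpedMass
  cn := if n = 2 then 4 else 5
  α := α
  β := β
  a := a
  b := b
  yd := yd
  yr := yr

end

/-!
The algorithm is an inexact accelerated proximal method, and the rate is that of Nesterov's scheme
in the norm of `S`.

One sweep of the algorithm treats `μ` and `(λ, p)` as two blocks. The two `p`-steps around the
`λ`-step amount to one joint `(λ, p)`-step with the proximal term `sGS(Q₂₂)`
(`DualData.IsAdmissible.mass_mulVec_phat_sub`). Adding the optimality conditions of the steps to the
exact expansion of the quadratic part gives a descent inequality against any feasible `w`
(`DualData.IsAdmissible.sweep_le`): the objective at the new iterate `z`, plus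
`½ ‖w - z‖²_S - ½ ‖w - zᵏ‖²_S`, plus the pairing of the errors with `w - z`, is at most the objective
at `w`. Taking for `w` the convex combination of the previous iterate and the solution, and scaling
by `tₖ²`, makes the usual energy telescope (`DualData.Run.energy_succ_le`).

The errors are paired with the displacement, whose `λ`- and `p`-components are bounded by the `S`-norm.
The `μ`-block `D₁` of `S` need not be shown to be definite: the positive semidefinite Hessian leaves
an extra term `‖d_μ + x_λ - x_p‖²_M` in the descent inequality, where `d` is the current and `x`
the preceding displacement, and this bounds `d_μ` (`DualData.HasErrorBound`). Hence the square root
of the energy grows by at most a multiple of `k εₖ` in step `k`, which is summable.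

What is needed about the finite elements is that the mass matrix `M` is positive definite, that `K` is
symmetric, and that `M ≤ W ≤ (n + 2) M`. The first of these bounds makes `D₂` positive semidefinite
and the second one `D₁`. The second bound holds cell by cell, because barycentric coordinates on a
simplex satisfy `∫ λᵥ² = 2 ∫ λᵥ λᵤ` for `v ≠ u`. This identity is shown without computing an integral:
the hyperplane `λᵥ = λᵤ` cuts the simplex into two halves, each of which is an affine image of the whole
simplex (`AffineBasis.setIntegral_fold`).
-/

/-! ### Moments of barycentric coordinates on a simplex -/

section SimplexMoments

variable {E : Type*} [NormedAddCommGroup E] [NormedSpace ℝ E]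

/-- Change of variables for an injective affine map. -/
theorem AffineMap.setIntegral_image [FiniteDimensional ℝ E] [MeasurableSpace E] [BorelSpace E]
    (μ : Measure E) [μ.IsAddHaarMeasure] (f : E →ᵃ[ℝ] E) (hf : Function.Injective f) {s : Set E}
    (hs : MeasurableSet s) (g : E → ℝ) :
    ∫ x in f '' s, g x ∂μ = |LinearMap.det f.linear| * ∫ x in s, g (f x) ∂μ := by
  have hd : ∀ x ∈ s, HasFDerivWithinAt f (LinearMap.toContinuousLinearMap f.linear) s x := by
    intro x _
    have h1 : HasFDerivAt (fun y => LinearMap.toContinuousLinearMap f.linear y + f 0)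
        (LinearMap.toContinuousLinearMap f.linear) x :=
      (ContinuousLinearMap.hasFDerivAt _).add_const _
    have h2 : (f : E → E) = fun y => LinearMap.toContinuousLinearMap f.linear y + f 0 := by
      rw [f.decomp]; simp; rfl
    rw [h2]
    exact h1.hasFDerivWithinAt
  rw [integral_image_eq_integral_abs_det_fderiv_smul μ hs hd hf.injOn g]
  simp [integral_const_mul]

namespace AffineBasis

variable {ι : Type*} (b : AffineBasis ι ℝ E)

/-- The affine map that transports the amount `ℓ x` of barycentric weight from `w` to `v`. -/
def transfer (v w : ι) (ℓ : E →ᵃ[ℝ] ℝ) : E →ᵃ[ℝ] E :=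
  AffineMap.id ℝ E + (LinearMap.toSpanSingleton ℝ E (b v - b w)).toAffineMap.comp ℓ

theorem transfer_apply (v w : ι) (ℓ : E →ᵃ[ℝ] ℝ) (x : E) :
    b.transfer v w ℓ x = x + ℓ x • (b v - b w) := by
  simp [transfer]

theorem coord_transfer [DecidableEq ι] (v w : ι) (ℓ : E →ᵃ[ℝ] ℝ) (x : E) (j : ι) :
    b.coord j (b.transfer v w ℓ x) =
      b.coord j x + ℓ x * ((if j = v then 1 else 0) - (if j = w then 1 else 0)) := by
  have h1 : b.coord j (b.transfer v w ℓ x)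
      = (b.coord j).linear (ℓ x • (b v - b w)) + b.coord j x := by
    rw [transfer_apply, add_comm, ← vadd_eq_add, AffineMap.map_vadd, vadd_eq_add]
  have h2 : (b.coord j).linear (b v - b w) = b.coord j (b v) - b.coord j (b w) := by
    have := AffineMap.linearMap_vsub (b.coord j) (b v) (b w)
    simpa using this
  rw [h1, map_smul, h2, coord_apply, coord_apply]
  simp only [smul_eq_mul]
  ring

theorem isCompact_convexHull [Finite ι] : IsCompact (convexHull ℝ (Set.range b)) :=
  (Set.finite_range b).isCompact_convexHull ℝ

theorem integrableOn_of_continuous [MeasurableSpace E] [OpensMeasurableSpace E]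
    (μ : Measure E) [IsFiniteMeasureOnCompacts μ] [Finite ι] {g : E → ℝ} (hg : Continuous g) :
    IntegrableOn g (convexHull ℝ (Set.range b)) μ :=
  hg.continuousOn.integrableOn_compact b.isCompact_convexHull

variable (v w : ι)

/-- Folding a simplex along the segment from `v` to `w` maps it onto the half on which the weight of
`v` dominates. -/
theorem image_transfer_half [Finite ι] (h : v ≠ w) :
    b.transfer v w ((1 / 2 : ℝ) • b.coord w) '' convexHull ℝ (Set.range b)
      = convexHull ℝ (Set.range b) ∩ {x | b.coord w x ≤ b.coord v x} := by
  classical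
  have hcoord := b.coord_transfer v w
  rw [b.convexHull_eq_nonneg_coord]
  ext y
  simp only [Set.mem_image, Set.mem_inter_iff, Set.mem_ofPred_eq]
  constructor
  · rintro ⟨x, hx, rfl⟩
    refine ⟨fun i => ?_, ?_⟩
    · rw [hcoord]
      have hi := hx i
      have hw := hx w
      by_cases h1 : i = v
      · subst h1
        simp [h]
        linarith
      · by_cases h2 : i = w
        · subst h2
          simp [h1]
          linarith
        · simpa [h1, h2] using hi
    · rw [hcoord, hcoord]
      have := hx v
      simp [h, h.symm]
      linarith
  · rintro ⟨h0, hle⟩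
    refine ⟨b.transfer v w (- b.coord w) y, fun i => ?_, ?_⟩
    · rw [hcoord]
      have hi := h0 i
      have hw := h0 w
      by_cases h1 : i = v
      · subst h1
        simp [h, hle]
      · by_cases h2 : i = w
        · subst h2
          simp [h1]
          linarith
        · simpa [h1, h2] using hi
    · apply b.ext_elem
      intro j
      rw [hcoord, hcoord]
      simp [hcoord, h.symm]
      ring

theorem transfer_half_injective [Finite ι] (h : v ≠ w) :
    Function.Injective (b.transfer v w ((1 / 2 : ℝ) • b.coord w)) := by
  classical
  intro x y hxy
  have hj : ∀ j, b.coord j (b.transfer v w ((1 / 2 : ℝ) • b.coord w) x) =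
      b.coord j (b.transfer v w ((1 / 2 : ℝ) • b.coord w) y) := fun j => by rw [hxy]
  simp only [coord_transfer] at hj
  have hw : b.coord w x = b.coord w y := by
    have := hj w
    simp [h.symm] at this
    linarith
  apply b.ext_elem
  intro j
  simpa [hw] using hj j

/-- The affine involution that exchanges the weights of `v` and `w`. -/
theorem coord_transfer_swap [DecidableEq ι] (h : v ≠ w) (x : E) (j : ι) :
    b.coord j (b.transfer v w (b.coord w - b.coord v) x) = b.coord (Equiv.swap v w j) x := by
  rw [coord_transfer]
  by_cases h1 : j = v
  · subst h1; simp [h]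
  · by_cases h2 : j = w
    · subst h2; simp [h.symm]
    · simp [h1, h2, Equiv.swap_apply_of_ne_of_ne h1 h2]

theorem transfer_swap_involutive [Finite ι] (h : v ≠ w) :
    Function.Involutive (b.transfer v w (b.coord w - b.coord v)) := by
  classical
  intro x
  apply b.ext_elem
  intro j
  rw [b.coord_transfer_swap v w h, b.coord_transfer_swap v w h, Equiv.swap_apply_self]

variable [FiniteDimensional ℝ E]

theorem continuous_coord (i : ι) : Continuous (b.coord i) :=
  AffineMap.continuous_of_finiteDimensional _

variable [MeasurableSpace E] [BorelSpace E] (μ : Measure E) [μ.IsAddHaarMeasure]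

theorem measure_coord_eq (h : v ≠ w) : μ {x | b.coord v x = b.coord w x} = 0 := by
  classical
  let s : AffineSubspace ℝ E :=
    (AffineSubspace.mk' (0 : ℝ) ⊥).comap (b.coord v - b.coord w)
  have hs : (s : Set E) = {x | b.coord v x = b.coord w x} := by
    ext x
    simp [s, AffineSubspace.mem_mk', sub_eq_zero]
  rw [← hs]
  refine Measure.addHaar_affineSubspace μ s fun htop => ?_
  have hv : b v ∈ (s : Set E) := by rw [htop]; trivial
  rw [hs] at hv
  simp [h.symm] at hv

/-- Halving the simplex by the hyperplane on which the weights of `v` and `w` agree, and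
stretching both halves to the full simplex. -/
theorem setIntegral_fold [Finite ι] (h : v ≠ w) {g : E → ℝ} (hg : Continuous g) :
    ∫ x in convexHull ℝ (Set.range b), g x ∂μ =
      |LinearMap.det (b.transfer v w ((1 / 2 : ℝ) • b.coord w)).linear| *
        ∫ x in convexHull ℝ (Set.range b),
          (g (b.transfer v w ((1 / 2 : ℝ) • b.coord w) x)
            + g (b.transfer v w (b.coord w - b.coord v)
              (b.transfer v w ((1 / 2 : ℝ) • b.coord w) x))) ∂μ := by
  classical
  set Δ := convexHull ℝ (Set.range b) with hΔ
  set τ := b.transfer v w ((1 / 2 : ℝ) • b.coord w) with hτ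
  set σ := b.transfer v w (b.coord w - b.coord v) with hσ
  have hσσ : Function.Involutive σ := b.transfer_swap_involutive v w h
  have hmΔ : MeasurableSet Δ := b.isCompact_convexHull.measurableSet
  have hcv := b.continuous_coord v
  have hcw := b.continuous_coord w
  have hσc : Continuous σ := AffineMap.continuous_of_finiteDimensional _
  have hmH : MeasurableSet (Δ ∩ {x | b.coord w x ≤ b.coord v x}) :=
    hmΔ.inter (measurableSet_le hcw.measurable hcv.measurable)
  have hdet : |LinearMap.det σ.linear| = 1 := by
    have h1 : σ.linear ∘ₗ σ.linear = LinearMap.id := by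
      rw [← AffineMap.comp_linear]
      have : σ.comp σ = AffineMap.id ℝ E := by ext x; exact hσσ x
      rw [this]; rfl
    have h2 : LinearMap.det σ.linear * LinearMap.det σ.linear = 1 := by
      rw [← LinearMap.det_comp, h1, LinearMap.det_id]
    have h3 : |LinearMap.det σ.linear| * |LinearMap.det σ.linear| = 1 := by
      rw [← abs_mul, h2, abs_one]
    nlinarith [abs_nonneg (LinearMap.det σ.linear)]
  have himσ : σ '' (Δ ∩ {x | b.coord w x ≤ b.coord v x})
      = Δ ∩ {x | b.coord v x ≤ b.coord w x} := by
    rw [hΔ, b.convexHull_eq_nonneg_coord, Set.image_eq_preimage_of_inverse hσσ.leftInverse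
      hσσ.rightInverse]
    ext x
    simp only [Set.mem_preimage, Set.mem_inter_iff, Set.mem_ofPred_eq, hσ,
      b.coord_transfer_swap v w h, Equiv.swap_apply_left, Equiv.swap_apply_right]
    refine and_congr_left fun _ => ⟨fun hx i => ?_, fun hx i => hx _⟩
    simpa using hx (Equiv.swap v w i)
  have hsplit : ∫ x in Δ, g x ∂μ = (∫ x in Δ ∩ {x | b.coord w x ≤ b.coord v x}, g x ∂μ)
      + ∫ x in Δ ∩ {x | b.coord v x ≤ b.coord w x}, g x ∂μ := by
    have hun : Δ = Δ ∩ {x | b.coord w x ≤ b.coord v x} ∪ Δ ∩ {x | b.coord v x ≤ b.coord w x} := by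
      ext x
      have := le_total (b.coord v x) (b.coord w x)
      simp only [Set.mem_union, Set.mem_inter_iff, Set.mem_ofPred_eq]
      tauto
    conv_lhs => rw [hun]
    refine setIntegral_union₀ ?_
      (hmΔ.inter (measurableSet_le hcv.measurable hcw.measurable)).nullMeasurableSet
      ((b.integrableOn_of_continuous μ hg).mono_set Set.inter_subset_left)
      ((b.integrableOn_of_continuous μ hg).mono_set Set.inter_subset_left)
    refine measure_mono_null ?_ (b.measure_coord_eq v w μ h)
    rintro x ⟨⟨_, h1⟩, ⟨_, h2⟩⟩
    exact le_antisymm h2 h1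
  have hgσ : Continuous fun x => g (σ x) := hg.comp hσc
  rw [hsplit, ← himσ, AffineMap.setIntegral_image μ σ hσσ.injective hmH, hdet, one_mul,
    ← integral_add
      ((b.integrableOn_of_continuous μ hg).mono_set Set.inter_subset_left)
      ((b.integrableOn_of_continuous μ hgσ).mono_set Set.inter_subset_left)]
  rw [hΔ, ← b.image_transfer_half v w h, ← hτ, ← hΔ]
  rw [AffineMap.setIntegral_image μ τ (b.transfer_half_injective v w h) hmΔ]

theorem two_mul_setIntegral_coord_mul_coord [Finite ι] (h : v ≠ w) :
    2 * ∫ x in convexHull ℝ (Set.range b), b.coord v x * b.coord w x ∂μ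
      = ∫ x in convexHull ℝ (Set.range b), b.coord w x ^ 2 ∂μ := by
  classical
  have hcv := b.continuous_coord v
  have hcw := b.continuous_coord w
  set d := |LinearMap.det (b.transfer v w ((1 / 2 : ℝ) • b.coord w)).linear| with hd
  -- integrating the constant `1` shows that the fold has determinant `1 / 2`
  have hV := b.setIntegral_fold v w μ h (g := fun _ => (1 : ℝ)) continuous_const
  have hvw : Continuous fun x => b.coord v x * b.coord w x := hcv.mul hcw
  have hww : Continuous fun x => 1 / 2 * b.coord w x ^ 2 := continuous_const.mul (hcw.pow 2)
  have hB := b.setIntegral_fold v w μ h (g := fun x => b.coord v x * b.coord w x) hvw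
  rw [← hd] at hV hB
  by_cases h0 : μ (convexHull ℝ (Set.range b)) = 0
  · simp [Measure.restrict_eq_zero.2 h0]
  have hfin : μ (convexHull ℝ (Set.range b)) ≠ ⊤ := b.isCompact_convexHull.measure_lt_top.ne
  have hpos : 0 < μ.real (convexHull ℝ (Set.range b)) := ENNReal.toReal_pos h0 hfin
  have hd2 : d = 1 / 2 := by
    simp only [integral_const, MeasurableSet.univ, measureReal_restrict_apply, Set.univ_inter,
      smul_eq_mul, mul_one] at hV
    have : μ.real (convexHull ℝ (Set.range b)) * (1 - 2 * d) = 0 := by linarith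
    rcases mul_eq_zero.1 this with h1 | h1 <;> linarith
  have hpt : ∀ x, b.coord v (b.transfer v w ((1 / 2 : ℝ) • b.coord w) x)
        * b.coord w (b.transfer v w ((1 / 2 : ℝ) • b.coord w) x)
      + b.coord v (b.transfer v w (b.coord w - b.coord v)
          (b.transfer v w ((1 / 2 : ℝ) • b.coord w) x))
        * b.coord w (b.transfer v w (b.coord w - b.coord v)
          (b.transfer v w ((1 / 2 : ℝ) • b.coord w) x))
      = b.coord v x * b.coord w x + 1 / 2 * b.coord w x ^ 2 := by
    intro x
    rw [b.coord_transfer_swap v w h, b.coord_transfer_swap v w h, Equiv.swap_apply_left,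
      Equiv.swap_apply_right, b.coord_transfer, b.coord_transfer]
    simp [h, h.symm]
    ring
  rw [integral_congr_ae (Filter.Eventually.of_forall hpt),
    integral_add (b.integrableOn_of_continuous μ hvw) (b.integrableOn_of_continuous μ hww),
    integral_const_mul, hd2] at hB
  linarith

/-- On an `n`-simplex the lumped mass matrix is at most `n + 2` times the mass matrix: the exact
moments satisfy `∫ λᵥ² = 2 ∫ λᵥ λᵤ`, hence `∫ λᵥ = (n + 2) / 2 * ∫ λᵥ²`. -/
theorem setIntegral_lumped_le [Fintype ι] (c : ι → ℝ) :
    ∫ x in convexHull ℝ (Set.range b), ∑ i, c i ^ 2 * b.coord i x ∂μ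
      ≤ (Fintype.card ι + 1) *
        ∫ x in convexHull ℝ (Set.range b), (∑ i, c i * b.coord i x) ^ 2 ∂μ := by
  classical
  have hc := b.continuous_coord
  have hint : ∀ {g : E → ℝ}, Continuous g → IntegrableOn g (convexHull ℝ (Set.range b)) μ :=
    fun hg => b.integrableOn_of_continuous μ hg
  have hc2 : ∀ i j, Continuous fun x => b.coord i x * b.coord j x := fun i j => (hc i).mul (hc j)
  have htwo := fun v w => b.two_mul_setIntegral_coord_mul_coord v w μ
  set Δ := convexHull ℝ (Set.range b) with hΔ
  clear_value Δ
  obtain ⟨i₀⟩ := b.nonempty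
  set A := ∫ x in Δ, b.coord i₀ x ^ 2 ∂μ with hA
  have hAnn : 0 ≤ A := integral_nonneg fun _ => sq_nonneg _
  have hsq : ∀ i, ∫ x in Δ, b.coord i x ^ 2 ∂μ = A := by
    intro i
    by_cases hi : i = i₀
    · rw [hi]
    · rw [hA, ← htwo i i₀ hi,
        ← htwo i₀ i (Ne.symm hi)]
      simp only [mul_comm]
  have hij : ∀ i j, ∫ x in Δ, b.coord i x * b.coord j x ∂μ
      = A / 2 + if i = j then A / 2 else 0 := by
    intro i j
    split_ifs with hi
    · subst hi
      rw [← hsq i]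
      simp only [← pow_two]
      ring
    · have := htwo i j hi
      rw [hsq j] at this
      linarith
  have h1 : ∀ i, ∫ x in Δ, b.coord i x ∂μ = (Fintype.card ι + 1) * (A / 2) := by
    intro i
    have : ∀ x, b.coord i x = ∑ j, b.coord i x * b.coord j x := fun x => by
      rw [← Finset.mul_sum, b.sum_coord_apply_eq_one, mul_one]
    rw [integral_congr_ae (Filter.Eventually.of_forall this),
      integral_finsetSum _ fun j _ => hint (hc2 i j)]
    simp only [hij, Finset.sum_add_distrib, Finset.sum_ite_eq, Finset.mem_univ, if_true,
      Finset.sum_const, Finset.card_univ, nsmul_eq_mul]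
    ring
  have hL : ∫ x in Δ, ∑ i, c i ^ 2 * b.coord i x ∂μ
      = (Fintype.card ι + 1) * (A / 2) * ∑ i, c i ^ 2 := by
    rw [integral_finsetSum _ fun j _ =>
      (hint (hc j)).const_mul _]
    simp only [integral_const_mul, h1, Finset.mul_sum]
    exact Finset.sum_congr rfl fun _ _ => by ring
  have hR : ∫ x in Δ, (∑ i, c i * b.coord i x) ^ 2 ∂μ
      = A / 2 * (∑ i, c i) ^ 2 + A / 2 * ∑ i, c i ^ 2 := by
    have : ∀ x, (∑ i, c i * b.coord i x) ^ 2
        = ∑ i, ∑ j, c i * c j * (b.coord i x * b.coord j x) := fun x => by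
      rw [pow_two, Finset.sum_mul_sum]
      exact Finset.sum_congr rfl fun _ _ => Finset.sum_congr rfl fun _ _ => by ring
    have hint2 : ∀ i j, IntegrableOn (fun x => c i * c j * (b.coord i x * b.coord j x)) Δ μ :=
      fun i j => (hint (hc2 i j)).const_mul _
    rw [integral_congr_ae (Filter.Eventually.of_forall this),
      integral_finsetSum _ fun i _ => integrable_finsetSum _ fun j _ => hint2 i j]
    simp only [integral_finsetSum _ fun j _ => hint2 _ j, integral_const_mul, hij]
    simp only [mul_add, Finset.sum_add_distrib, mul_ite, mul_zero, Finset.sum_ite_eq,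
      Finset.mem_univ, if_true]
    rw [pow_two, Finset.sum_mul_sum, Finset.mul_sum, Finset.mul_sum]
    congr 1
    · refine Finset.sum_congr rfl fun i _ => ?_
      rw [Finset.mul_sum]
      exact Finset.sum_congr rfl fun _ _ => by ring
    · exact Finset.sum_congr rfl fun _ _ => by ring
  rw [hL, hR]
  have : 0 ≤ A / 2 * (∑ i, c i) ^ 2 := by positivity
  have hn : (0 : ℝ) ≤ Fintype.card ι + 1 := by positivity
  nlinarith [mul_nonneg hn this]

end AffineBasis

end SimplexMoments

/-! ### Hat functions on a triangulation -/

theorem measure_frontier_biUnion_eq_zero {X ι : Type*} [TopologicalSpace X] [MeasurableSpace X]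
    (μ : Measure X) {S : Set ι} (hS : S.Finite) (f : ι → Set X)
    (h : ∀ i ∈ S, μ (frontier (f i)) = 0) : μ (frontier (⋃ i ∈ S, f i)) = 0 := by
  induction S, hS using Set.Finite.induction_on with
  | empty => simp
  | @insert a S _ _ ih =>
    rw [Set.biUnion_insert]
    refine measure_mono_null (frontier_union_subset _ _) (measure_union_null ?_ ?_)
    · exact measure_mono_null Set.inter_subset_left (h a (Set.mem_insert _ _))
    · exact measure_mono_null Set.inter_subset_right
        (ih fun i hi => h i (Set.mem_insert_of_mem _ hi))

namespace Triangulation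

variable {n : ℕ} (T : Triangulation n)

/-- The cells of a triangulation, i.e. its `n`-dimensional simplices. -/
def cells : Set (Finset (EuclideanSpace ℝ (Fin n))) := {s ∈ T.complex.faces | s.card = n + 1}

theorem finite_cells : T.cells.Finite := T.finite_faces.subset fun _ h => h.1

/-- The vertices of a cell as an affine basis of the whole space. -/
def cellBasis (s : T.cells) : AffineBasis s.1 ℝ (EuclideanSpace ℝ (Fin n)) where
  toFun := (↑)
  ind' := T.complex.indep s.2.1
  tot' := (T.complex.indep s.2.1).affineSpan_eq_top_iff_card_eq_finrank_add_one.2 <| by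
    simp [s.2.2]

theorem cellBasis_apply (s : T.cells) (y : s.1) : T.cellBasis s y = y := rfl

theorem range_cellBasis (s : T.cells) :
    Set.range (T.cellBasis s) = (s.1 : Set (EuclideanSpace ℝ (Fin n))) :=
  Subtype.range_coe

/-- The closed simplex spanned by the vertices of a cell. -/
def cellSet (s : T.cells) : Set (EuclideanSpace ℝ (Fin n)) := convexHull ℝ (s.1 : Set _)

theorem cellSet_eq (s : T.cells) : T.cellSet s = convexHull ℝ (Set.range (T.cellBasis s)) := by
  rw [range_cellBasis, cellSet]

theorem isCompact_cellSet (s : T.cells) : IsCompact (T.cellSet s) := by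
  rw [cellSet_eq]; exact (T.cellBasis s).isCompact_convexHull

theorem space_eq_iUnion : T.complex.space = ⋃ s : T.cells, T.cellSet s := by
  refine Set.Subset.antisymm (fun x hx => ?_) (Set.iUnion_subset fun s =>
    T.complex.convexHull_subset_space s.2.1)
  obtain ⟨s, hs, hx⟩ := T.complex.mem_space_iff.1 hx
  obtain ⟨t, ht, hst, hcard⟩ := T.pure_dim s hs
  exact Set.mem_iUnion.2 ⟨⟨t, ht, hcard⟩, convexHull_mono (by exact_mod_cast hst) hx⟩

instance : Finite T.cells := T.finite_cells.to_subtype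

theorem isCompact_space : IsCompact T.complex.space := by
  rw [space_eq_iUnion]; exact isCompact_iUnion T.isCompact_cellSet

theorem domain_ae_eq_space : T.domain =ᵐ[volume] T.complex.space := by
  refine interior_ae_eq_of_null_frontier ?_
  refine measure_frontier_biUnion_eq_zero volume T.finite_faces
    (fun s => convexHull ℝ (s : Set (EuclideanSpace ℝ (Fin n)))) fun s _ => ?_
  exact (convex_convexHull ℝ _).addHaar_frontier volume

theorem affineSpan_cell_inter_ne_top {s t : T.cells} (hst : s ≠ t) :
    affineSpan ℝ ((s.1 : Set (EuclideanSpace ℝ (Fin n))) ∩ t.1) ≠ ⊤ := by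
  classical
  intro htop
  have hind : AffineIndependent ℝ ((↑) : ↥(s.1 ∩ t.1) → EuclideanSpace ℝ (Fin n)) :=
    AffineIndependent.mono (T.complex.indep s.2.1)
      (Finset.coe_subset.2 (Finset.inter_subset_left (s₁ := s.1) (s₂ := t.1)))
  have hrange : Set.range ((↑) : ↥(s.1 ∩ t.1) → EuclideanSpace ℝ (Fin n))
      = (s.1 : Set (EuclideanSpace ℝ (Fin n))) ∩ t.1 := by
    rw [← Finset.coe_inter]
    exact Subtype.range_coe
  have hcard := hind.affineSpan_eq_top_iff_card_eq_finrank_add_one.1 (by rw [hrange, htop])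
  rw [Fintype.card_coe, finrank_euclideanSpace, Fintype.card_fin] at hcard
  have h1 : s.1 ∩ t.1 = s.1 :=
    Finset.eq_of_subset_of_card_le Finset.inter_subset_left (by rw [hcard, s.2.2])
  have h2 : s.1 ∩ t.1 = t.1 :=
    Finset.eq_of_subset_of_card_le Finset.inter_subset_right (by rw [hcard, t.2.2])
  exact hst (Subtype.ext (h1.symm.trans h2))

theorem volume_cellSet_inter {s t : T.cells} (hst : s ≠ t) :
    volume (T.cellSet s ∩ T.cellSet t) = 0 :=
  measure_mono_null ((T.complex.inter_subset_convexHull s.2.1 t.2.1).trans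
    (convexHull_subset_affineSpan _))
    (Measure.addHaar_affineSubspace volume _ (T.affineSpan_cell_inter_ne_top hst))

open Classical in
theorem isBarycentricWeight_coord (s : T.cells) {x : EuclideanSpace ℝ (Fin n)}
    (hx : x ∈ T.cellSet s) :
    IsBarycentricWeight T.complex x
      (fun y => if h : y ∈ s.1 then (T.cellBasis s).coord ⟨y, h⟩ x else 0) := by
  rw [cellSet_eq, AffineBasis.convexHull_eq_nonneg_coord] at hx
  refine ⟨s.1, s.2.1, fun y hy => ?_, fun y hy => dif_neg hy, ?_, ?_⟩
  · simpa [hy] using hx ⟨y, hy⟩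
  · rw [← Finset.sum_coe_sort s.1 (fun y =>
      if h : y ∈ s.1 then (T.cellBasis s).coord ⟨y, h⟩ x else 0)]
    simpa using (T.cellBasis s).sum_coord_apply_eq_one x
  · rw [← Finset.sum_coe_sort s.1 (fun y =>
      (if h : y ∈ s.1 then (T.cellBasis s).coord ⟨y, h⟩ x else 0) • y)]
    simpa [cellBasis_apply] using (T.cellBasis s).linear_combination_coord_eq_self x

open Classical in
theorem hat_eq_coord (s : T.cells) {x : EuclideanSpace ℝ (Fin n)} (hx : x ∈ T.cellSet s)
    (v : EuclideanSpace ℝ (Fin n)) :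
    hat T.complex v x = if h : v ∈ s.1 then (T.cellBasis s).coord ⟨v, h⟩ x else 0 :=
  hat_eq (T.isBarycentricWeight_coord s hx) v

theorem continuousOn_hat (v : EuclideanSpace ℝ (Fin n)) :
    ContinuousOn (hat T.complex v) T.complex.space := by
  classical
  rw [space_eq_iUnion]
  refine (locallyFinite_of_finite _).continuousOn_iUnion
    (fun s => (T.isCompact_cellSet s).isClosed) fun s => ?_
  refine ContinuousOn.congr ?_ fun x hx => T.hat_eq_coord s hx v
  by_cases h : v ∈ s.1
  · simpa [h] using ((T.cellBasis s).continuous_coord _).continuousOn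
  · simpa [h] using continuousOn_const

theorem continuousOn_basisFun (i : Fin T.N) : ContinuousOn (T.basisFun i) T.complex.space :=
  T.continuousOn_hat _

theorem hat_vertex (v w : EuclideanSpace ℝ (Fin n)) (hv : v ∈ T.complex.vertices) :
    hat T.complex w v = if w = v then 1 else 0 := by
  classical
  refine hat_eq (w := fun y => if y = v then 1 else 0) ⟨{v}, hv, ?_, ?_, ?_, ?_⟩ w <;> simp

theorem node_mem_vertices (i : Fin T.N) : T.node i ∈ T.complex.vertices :=
  (T.range_node.subset (Set.mem_range_self i)).1

theorem node_mem_domain (i : Fin T.N) : T.node i ∈ T.domain :=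
  (T.range_node.subset (Set.mem_range_self i)).2

theorem basisFun_node (i j : Fin T.N) : T.basisFun i (T.node j) = if i = j then 1 else 0 := by
  rw [basisFun, T.hat_vertex _ _ (T.node_mem_vertices j)]
  simp [T.node_injective.eq_iff]

theorem feFun_node (c : Fin T.N → ℝ) (j : Fin T.N) : T.feFun c (T.node j) = c j := by
  simp [feFun, basisFun_node]

theorem continuousOn_feFun (c : Fin T.N → ℝ) : ContinuousOn (T.feFun c) T.complex.space :=
  continuousOn_finsetSum _ fun i _ => continuousOn_const.mul (T.continuousOn_basisFun i)

theorem basisFun_nonneg (i : Fin T.N) {x : EuclideanSpace ℝ (Fin n)} (hx : x ∈ T.complex.space) :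
    0 ≤ T.basisFun i x := by
  rw [space_eq_iUnion] at hx
  obtain ⟨s, hs⟩ := Set.mem_iUnion.1 hx
  rw [basisFun, T.hat_eq_coord s hs]
  split_ifs with h
  · rw [cellSet_eq, AffineBasis.convexHull_eq_nonneg_coord] at hs
    exact hs _
  · exact le_rfl

/-- On a cell only the basis functions of its own vertices contribute to a combination. -/
theorem sum_basisFun_eq_sum_coord (s : T.cells) {x : EuclideanSpace ℝ (Fin n)}
    (hx : x ∈ T.cellSet s) (c : Fin T.N → ℝ) :
    ∑ i, c i * T.basisFun i x
      = ∑ y : s.1, Function.extend T.node c 0 y * (T.cellBasis s).coord y x := by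
  classical
  have h1 : ∑ i, c i * T.basisFun i x
      = ∑ y ∈ Finset.univ.image T.node, Function.extend T.node c 0 y * hat T.complex y x := by
    rw [Finset.sum_image fun a _ b _ h => T.node_injective h]
    exact Finset.sum_congr rfl fun i _ => by rw [T.node_injective.extend_apply]; rfl
  have h2 : ∑ y : s.1, Function.extend T.node c 0 y * (T.cellBasis s).coord y x
      = ∑ y ∈ s.1, Function.extend T.node c 0 y * hat T.complex y x := by
    rw [← Finset.sum_coe_sort s.1]
    exact Finset.sum_congr rfl fun y _ => by rw [T.hat_eq_coord s hx, dif_pos y.2]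
  rw [h1, h2]
  -- both sums only see the interior nodes that are vertices of the cell
  have h3 : ∑ y ∈ Finset.univ.image T.node ∩ s.1,
        Function.extend T.node c 0 y * hat T.complex y x
      = ∑ y ∈ Finset.univ.image T.node, Function.extend T.node c 0 y * hat T.complex y x :=
    Finset.sum_subset Finset.inter_subset_left fun y hy hys => by
      rw [T.hat_eq_coord s hx, dif_neg fun h => hys (Finset.mem_inter.2 ⟨hy, h⟩), mul_zero]
  have h4 : ∑ y ∈ Finset.univ.image T.node ∩ s.1,
        Function.extend T.node c 0 y * hat T.complex y x
      = ∑ y ∈ s.1, Function.extend T.node c 0 y * hat T.complex y x :=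
    Finset.sum_subset Finset.inter_subset_right fun y hy hys => by
      rw [Function.extend_apply' _ _ _ fun ⟨i, hi⟩ => hys (Finset.mem_inter.2
        ⟨Finset.mem_image.2 ⟨i, Finset.mem_univ _, hi⟩, hy⟩), Pi.zero_apply, zero_mul]
  rw [← h3, h4]

theorem sum_basisFun_le_one {x : EuclideanSpace ℝ (Fin n)} (hx : x ∈ T.complex.space) :
    ∑ i, T.basisFun i x ≤ 1 := by
  classical
  rw [space_eq_iUnion] at hx
  obtain ⟨s, hs⟩ := Set.mem_iUnion.1 hx
  have h := T.sum_basisFun_eq_sum_coord s hs (fun _ => 1)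
  simp only [one_mul] at h
  rw [cellSet_eq, AffineBasis.convexHull_eq_nonneg_coord] at hs
  refine h.trans_le (le_trans ?_ ((T.cellBasis s).sum_coord_apply_eq_one x).le)
  refine Finset.sum_le_sum fun y _ => mul_le_of_le_one_left (hs y) ?_
  by_cases hy : ∃ i, T.node i = y
  · obtain ⟨i, hi⟩ := hy
    rw [← hi, T.node_injective.extend_apply]
  · rw [Function.extend_apply' _ _ _ hy]
    exact zero_le_one

/-! ### Mass matrix and lumped mass matrix -/

theorem integrableOn_domain {g : EuclideanSpace ℝ (Fin n) → ℝ}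
    (hg : ContinuousOn g T.complex.space) : IntegrableOn g T.domain :=
  (hg.integrableOn_compact T.isCompact_space).mono_set interior_subset

theorem dotProduct_mass_mulVec (x y : Fin T.N → ℝ) :
    x ⬝ᵥ (T.mass *ᵥ y) = ∫ z in T.domain, T.feFun x z * T.feFun y z := by
  have hint : ∀ i j, IntegrableOn (fun z => x i * (y j * (T.basisFun i z * T.basisFun j z)))
      T.domain := fun i j => T.integrableOn_domain <| continuousOn_const.mul <|
        continuousOn_const.mul <| (T.continuousOn_basisFun i).mul (T.continuousOn_basisFun j)
  have h : ∀ z, T.feFun x z * T.feFun y z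
      = ∑ i, ∑ j, x i * (y j * (T.basisFun i z * T.basisFun j z)) := fun z => by
    rw [feFun, feFun, Finset.sum_mul_sum]
    exact Finset.sum_congr rfl fun _ _ => Finset.sum_congr rfl fun _ _ => by ring
  rw [integral_congr_ae (Filter.Eventually.of_forall h),
    integral_finsetSum _ fun i _ => integrable_finsetSum _ fun j _ => hint i j]
  simp only [integral_finsetSum _ fun j _ => hint _ j, integral_const_mul, dotProduct, mulVec,
    mass, Matrix.of_apply, Finset.mul_sum]
  exact Finset.sum_congr rfl fun _ _ => Finset.sum_congr rfl fun _ _ => by ring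

theorem normSqM_mass (x : Fin T.N → ℝ) :
    normSqM T.mass x = ∫ z in T.domain, T.feFun x z ^ 2 := by
  simp only [normSqM, dotProduct_mass_mulVec, pow_two]

theorem normSqM_lumpedMass (x : Fin T.N → ℝ) :
    normSqM T.lumpedMass x = ∫ z in T.domain, ∑ i, x i ^ 2 * T.basisFun i z := by
  rw [integral_finsetSum _ fun i _ =>
    (T.integrableOn_domain (T.continuousOn_basisFun i)).const_mul _]
  simp only [integral_const_mul, normSqM, lumpedMass, mulVec_diagonal, dotProduct]
  exact Finset.sum_congr rfl fun _ _ => by ring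

theorem mass_isSymm : T.mass.IsSymm := by
  ext i j
  simp only [mass, transpose_apply, Matrix.of_apply, mul_comm]

/-- A continuous nonnegative function that is positive at an interior node has positive integral. -/
theorem setIntegral_domain_pos {g : EuclideanSpace ℝ (Fin n) → ℝ}
    (hg : ContinuousOn g T.complex.space) (h0 : ∀ x ∈ T.complex.space, 0 ≤ g x) (i : Fin T.N)
    (hi : g (T.node i) ≠ 0) : 0 < ∫ z in T.domain, g z := by
  have hnn : 0 ≤ᵐ[volume.restrict T.domain] g :=
    (ae_restrict_iff' isOpen_interior.measurableSet).2 <|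
      Filter.Eventually.of_forall fun x hx => h0 x (interior_subset hx)
  refine lt_of_le_of_ne (integral_nonneg_of_ae hnn) fun hz => hi ?_
  have hae := (setIntegral_eq_zero_iff_of_nonneg_ae hnn (T.integrableOn_domain hg)).1 hz.symm
  exact Measure.eqOn_open_of_ae_eq hae isOpen_interior (hg.mono interior_subset)
    continuousOn_const (T.node_mem_domain i)

theorem mass_posDef : T.mass.PosDef := by
  refine PosDef.of_dotProduct_mulVec_pos (by
    rw [IsHermitian, conjTranspose_eq_transpose_of_trivial]; exact T.mass_isSymm)
   
    fun x hx => ?_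
  obtain ⟨i, hi⟩ := Function.ne_iff.1 hx
  have := T.setIntegral_domain_pos ((T.continuousOn_feFun x).pow 2) (fun _ _ => sq_nonneg _) i
    (by simpa [feFun_node] using hi)
  rw [star_trivial, ← normSqM, normSqM_mass]
  exact this

theorem lumpedMass_posDef : T.lumpedMass.PosDef :=
  PosDef.diagonal fun i => T.setIntegral_domain_pos (T.continuousOn_basisFun i)
    (fun _ hx => T.basisFun_nonneg i hx) i (by simp [basisFun_node])

/-- Pointwise Cauchy-Schwarz, since the basis functions are nonnegative with sum at most one. -/
theorem normSqM_mass_le_lumpedMass (x : Fin T.N → ℝ) :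
    normSqM T.mass x ≤ normSqM T.lumpedMass x := by
  rw [normSqM_mass, normSqM_lumpedMass]
  refine setIntegral_mono_on (T.integrableOn_domain ((T.continuousOn_feFun x).pow 2))
    (T.integrableOn_domain (continuousOn_finsetSum _ fun i _ =>
      continuousOn_const.mul (T.continuousOn_basisFun i)))
    isOpen_interior.measurableSet fun z hz => ?_
  have hz := interior_subset hz
  have h0 := fun i => T.basisFun_nonneg i hz
  have hS : 0 ≤ ∑ i, x i ^ 2 * T.basisFun i z :=
    Finset.sum_nonneg fun i _ => mul_nonneg (sq_nonneg _) (h0 i)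
  calc T.feFun x z ^ 2
      ≤ (∑ i, x i ^ 2 * T.basisFun i z) * ∑ i, T.basisFun i z :=
        Finset.sum_sq_le_sum_mul_sum_of_sq_le_mul _
          (fun i _ => mul_nonneg (sq_nonneg _) (h0 i)) (fun i _ => h0 i) fun i _ => le_of_eq (by ring)
    _ ≤ ∑ i, x i ^ 2 * T.basisFun i z :=
        mul_le_of_le_one_right hS (T.sum_basisFun_le_one hz)

theorem setIntegral_domain_eq_sum [Fintype T.cells] {g : EuclideanSpace ℝ (Fin n) → ℝ}
    (hg : ContinuousOn g T.complex.space) :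
    ∫ z in T.domain, g z = ∑ s : T.cells, ∫ z in T.cellSet s, g z := by
  rw [setIntegral_congr_set T.domain_ae_eq_space]
  have hi := hg.integrableOn_compact (μ := volume) T.isCompact_space
  rw [space_eq_iUnion] at hi ⊢
  rw [integral_iUnion_ae (fun s => (T.isCompact_cellSet s).measurableSet.nullMeasurableSet)
    (fun s t hst => T.volume_cellSet_inter hst) hi, tsum_fintype]

/-- This is where the constant `cₙ = n + 2` comes from: the cellwise bound, summed over all cells. -/
theorem normSqM_lumpedMass_le_mass (x : Fin T.N → ℝ) :
    normSqM T.lumpedMass x ≤ (n + 2) * normSqM T.mass x := by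
  have := Fintype.ofFinite T.cells
  rw [normSqM_mass, normSqM_lumpedMass,
    T.setIntegral_domain_eq_sum (g := fun z => T.feFun x z ^ 2) ((T.continuousOn_feFun x).pow 2),
    T.setIntegral_domain_eq_sum (g := fun z => ∑ i, x i ^ 2 * T.basisFun i z)
      (continuousOn_finsetSum _ fun i _ => continuousOn_const.mul (T.continuousOn_basisFun i)),
    Finset.mul_sum]
  refine Finset.sum_le_sum fun s _ => ?_
  have hm := (T.isCompact_cellSet s).measurableSet
  have h := (T.cellBasis s).setIntegral_lumped_le volume
    fun y => Function.extend T.node x 0 y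
  rw [← cellSet_eq, Fintype.card_coe, s.2.2] at h
  have hsq : ∀ y, Function.extend T.node (fun i => x i ^ 2) 0 y
      = Function.extend T.node x 0 y ^ 2 := fun y => by
    by_cases hy : ∃ i, T.node i = y
    · obtain ⟨i, rfl⟩ := hy
      simp only [T.node_injective.extend_apply]
    · simp [Function.extend_apply' _ _ _ hy]
  have hl : ∫ z in T.cellSet s, ∑ i, x i ^ 2 * T.basisFun i z = ∫ z in T.cellSet s,
      ∑ y : s.1, Function.extend T.node x 0 y ^ 2 * (T.cellBasis s).coord y z :=
    setIntegral_congr_fun hm fun z hz => by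
      simp only [T.sum_basisFun_eq_sum_coord s hz fun i => x i ^ 2, hsq]
  have hr : ∫ z in T.cellSet s, T.feFun x z ^ 2 = ∫ z in T.cellSet s,
      (∑ y : s.1, Function.extend T.node x 0 y * (T.cellBasis s).coord y z) ^ 2 :=
    setIntegral_congr_fun hm fun z hz => by
      simp only [feFun, T.sum_basisFun_eq_sum_coord s hz]
  rw [hl, hr]
  push_cast at h
  linarith

/-- The stiffness matrix is symmetric because the coefficient matrix is. -/
theorem stiffness_isSymm {Ω : Set (EuclideanSpace ℝ (Fin n))}
    {A : EuclideanSpace ℝ (Fin n) → Matrix (Fin n) (Fin n) ℝ} {c : EuclideanSpace ℝ (Fin n) → ℝ}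
    (hA : ∀ᵐ x ∂(volume.restrict Ω), ∀ i j, A x i j = A x j i) :
    (T.stiffness Ω A c).IsSymm := by
  ext i j
  simp only [stiffness, transpose_apply, Matrix.of_apply]
  refine integral_congr_ae ?_
  filter_upwards [hA] with x hx
  rw [Finset.sum_comm]
  congr 1
  · refine Finset.sum_congr rfl fun k _ => Finset.sum_congr rfl fun l _ => ?_
    rw [hx k l]
    ring
  · ring

end Triangulation

/-! ### Quadratic forms of symmetric matrices -/

section NormSqM

variable {ι : Type*} [Fintype ι]

theorem Matrix.IsSymm.dotProduct_mulVec_comm {A : Matrix ι ι ℝ} (hA : A.IsSymm) (x y : ι → ℝ) :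
    x ⬝ᵥ (A *ᵥ y) = y ⬝ᵥ (A *ᵥ x) := by
  rw [dotProduct_mulVec, ← mulVec_transpose, hA.eq, dotProduct_comm]

theorem normSqM_add {A : Matrix ι ι ℝ} (hA : A.IsSymm) (x y : ι → ℝ) :
    normSqM A (x + y) = normSqM A x + 2 * (x ⬝ᵥ (A *ᵥ y)) + normSqM A y := by
  simp only [normSqM, mulVec_add, dotProduct_add, add_dotProduct]
  rw [hA.dotProduct_mulVec_comm y x]
  ring

theorem normSqM_smul (A : Matrix ι ι ℝ) (s : ℝ) (x : ι → ℝ) :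
    normSqM A (s • x) = s ^ 2 * normSqM A x := by
  simp only [normSqM, mulVec_smul, dotProduct_smul, smul_dotProduct, smul_eq_mul]
  ring

theorem normSqM_add_smul {A : Matrix ι ι ℝ} (hA : A.IsSymm) (x d : ι → ℝ) (s : ℝ) :
    normSqM A (x + s • d) = normSqM A x + s * (2 * (d ⬝ᵥ (A *ᵥ x))) + s ^ 2 * normSqM A d := by
  rw [normSqM_add hA, normSqM_smul, hA.dotProduct_mulVec_comm, smul_dotProduct, smul_eq_mul]
  ring

theorem Matrix.PosDef.isSymm {ι : Type*} {A : Matrix ι ι ℝ} (hA : A.PosDef) : A.IsSymm := by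
  have := hA.isHermitian
  rwa [IsHermitian, conjTranspose_eq_transpose_of_trivial] at this

theorem Matrix.PosDef.normSqM_nonneg {A : Matrix ι ι ℝ} (hA : A.PosDef) (x : ι → ℝ) :
    0 ≤ normSqM A x := by
  simpa [normSqM] using hA.posSemidef.dotProduct_mulVec_nonneg x

theorem Matrix.PosDef.inv_mulVec_mulVec [DecidableEq ι] {A : Matrix ι ι ℝ} (hA : A.PosDef)
    (x : ι → ℝ) : A⁻¹ *ᵥ (A *ᵥ x) = x := by
  rw [mulVec_mulVec, nonsing_inv_mul _ ((isUnit_iff_isUnit_det _).1 hA.isUnit), one_mulVec]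

end NormSqM

/-! ### Tools for first order conditions -/

/-- The directional derivative `l` at a minimizer is nonnegative. -/
theorem nonneg_of_forall_quadratic {l h : ℝ} (H : ∀ s : ℝ, 0 < s → s ≤ 1 → 0 ≤ s * l + s ^ 2 * h) :
    0 ≤ l := by
  by_contra! hl
  have hh : 0 < |h| + 1 := by positivity
  have hq : 0 < -l / 2 / (|h| + 1) := div_pos (by linarith) hh
  set s := min 1 (-l / 2 / (|h| + 1)) with hs
  have hs0 : 0 < s := lt_min one_pos hq
  have hs1 : s * (|h| + 1) ≤ -l / 2 := (le_div_iff₀ hh).1 (min_le_right _ _)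
  have hs2 : s * h ≤ s * |h| := mul_le_mul_of_nonneg_left (le_abs_self h) hs0.le
  have h1 : s * (l + s * h) < 0 := mul_neg_of_pos_of_neg hs0 (by linarith)
  have h2 := H s hs0 (min_le_left _ _)
  linarith [show s * (l + s * h) = s * l + s ^ 2 * h by ring]

theorem bddAbove_supportFun {N : ℕ} (a b : ℝ) (ξ : Fin N → ℝ) :
    BddAbove ((fun u : Fin N → ℝ => u ⬝ᵥ ξ) '' {u | ∀ i, a ≤ u i ∧ u i ≤ b}) := by
  refine ⟨∑ i, max |a| |b| * |ξ i|, ?_⟩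
  rintro _ ⟨u, hu, rfl⟩
  refine Finset.sum_le_sum fun i _ => (le_abs_self _).trans ?_
  rw [abs_mul]
  exact mul_le_mul_of_nonneg_right (abs_le_max_abs_abs (hu i).1 (hu i).2) (abs_nonneg _)

theorem supportFun_convex {N : ℕ} {a b : ℝ} (hab : a ≤ b) (ξ η : Fin N → ℝ) {s : ℝ} (h0 : 0 ≤ s)
    (h1 : s ≤ 1) : supportFun a b ((1 - s) • ξ + s • η)
      ≤ (1 - s) * supportFun a b ξ + s * supportFun a b η := by
  refine csSup_le (Set.Nonempty.image _ ⟨fun _ => a, fun _ => ⟨le_rfl, hab⟩⟩) ?_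
  rintro _ ⟨u, hu, rfl⟩
  have h2 : u ⬝ᵥ ξ ≤ supportFun a b ξ := le_csSup (bddAbove_supportFun a b ξ) ⟨u, hu, rfl⟩
  have h3 : u ⬝ᵥ η ≤ supportFun a b η := le_csSup (bddAbove_supportFun a b η) ⟨u, hu, rfl⟩
  simp only [dotProduct_add, dotProduct_smul, smul_eq_mul]
  have := mul_le_mul_of_nonneg_left h2 (sub_nonneg.2 h1)
  have := mul_le_mul_of_nonneg_left h3 h0
  linarith

/-! ### The proximal matrices -/

namespace DualData

variable {N : ℕ} (D : DualData N)

/-- The properties of the data of the dual problem that the convergence analysis uses. -/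
structure IsAdmissible : Prop where
  mass_posDef : D.M.PosDef
  stiffness_isSymm : D.K.IsSymm
  lumped_posDef : D.W.PosDef
  mass_le_lumped : ∀ x, normSqM D.M x ≤ normSqM D.W x
  lumped_le_mass : ∀ x, normSqM D.W x ≤ D.cn * normSqM D.M x
  cn_pos : 0 < D.cn
  α_pos : 0 < D.α
  a_le_b : D.a ≤ D.b
  β_nonneg : 0 ≤ D.β

/-- The matrix `K M⁻¹ K`. -/
noncomputable def KMK : Matrix (Fin N) (Fin N) ℝ := D.K * D.M⁻¹ * D.K

/-- The Hessian `M / α + K M⁻¹ K` of the `p`-subproblems. -/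
noncomputable def hessP : Matrix (Fin N) (Fin N) ℝ := (1 / D.α) • D.M + D.KMK

/-- The `λ`-block `(M / α) P⁻¹ (M / α) + (W - M) / α` of `D₂`, with `P` the Hessian of the
`p`-subproblems. -/
noncomputable def D2lam : Matrix (Fin N) (Fin N) ℝ :=
  ((1 / D.α) • D.M) * D.hessP⁻¹ * ((1 / D.α) • D.M) + (1 / D.α) • (D.W - D.M)

variable {D}

theorem IsAdmissible.KMK_isSymm (hD : D.IsAdmissible) : D.KMK.IsSymm := by
  rw [IsSymm, KMK, transpose_mul, transpose_mul, transpose_nonsing_inv,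
    hD.mass_posDef.isSymm.eq, hD.stiffness_isSymm.eq, Matrix.mul_assoc]

theorem IsAdmissible.normSqM_KMK (hD : D.IsAdmissible) (x : Fin N → ℝ) :
    normSqM D.KMK x = normSqM D.M⁻¹ (D.K *ᵥ x) := by
  rw [normSqM, normSqM, KMK, ← mulVec_mulVec, ← mulVec_mulVec,
    hD.stiffness_isSymm.dotProduct_mulVec_comm, dotProduct_comm]

theorem IsAdmissible.normSqM_KMK_nonneg (hD : D.IsAdmissible) (x : Fin N → ℝ) :
    0 ≤ normSqM D.KMK x := by
  rw [hD.normSqM_KMK]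
  exact hD.mass_posDef.inv.normSqM_nonneg _

theorem IsAdmissible.hessP_posDef (hD : D.IsAdmissible) : D.hessP.PosDef := by
  have hs : D.hessP.IsSymm := (hD.mass_posDef.isSymm.smul _).add hD.KMK_isSymm
  refine PosDef.of_dotProduct_mulVec_pos
    (by rw [IsHermitian, conjTranspose_eq_transpose_of_trivial]; exact hs) fun x hx => ?_
  have h1 : 0 < x ⬝ᵥ (D.M *ᵥ x) := by simpa using hD.mass_posDef.dotProduct_mulVec_pos hx
  have h2 : 0 ≤ x ⬝ᵥ (D.KMK *ᵥ x) := hD.normSqM_KMK_nonneg x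
  have hα := hD.α_pos
  rw [star_trivial, hessP, add_mulVec, smul_mulVec, dotProduct_add, dotProduct_smul, smul_eq_mul]
  positivity

theorem IsAdmissible.D1_isSymm (hD : D.IsAdmissible) : D.D1.IsSymm := by
  have hM := hD.mass_posDef.isSymm
  have h : (D.M * D.W⁻¹ * D.M).IsSymm := by
    rw [IsSymm, transpose_mul, transpose_mul, transpose_nonsing_inv, hM.eq,
      hD.lumped_posDef.isSymm.eq, Matrix.mul_assoc]
  exact ((h.smul _).smul _).sub (hM.smul _)

/-- `D₁` is positive semidefinite: this follows from `W ≤ cₙ M` by expanding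
`0 ≤ ‖cₙ M x - W x‖²` in the norm of `W⁻¹`. -/
theorem IsAdmissible.normSqM_D1_nonneg (hD : D.IsAdmissible) (x : Fin N → ℝ) :
    0 ≤ normSqM D.D1 x := by
  have hα := hD.α_pos
  have hc := hD.cn_pos
  have h0 := hD.lumped_posDef.inv.normSqM_nonneg (D.cn • (D.M *ᵥ x) + (-1 : ℝ) • (D.W *ᵥ x))
  rw [normSqM_add hD.lumped_posDef.inv.isSymm, normSqM_smul, normSqM_smul] at h0
  have h1 : normSqM D.W⁻¹ (D.W *ᵥ x) = normSqM D.W x := by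
    rw [normSqM, hD.lumped_posDef.inv_mulVec_mulVec, dotProduct_comm, normSqM]
  have h2 : (D.cn • (D.M *ᵥ x)) ⬝ᵥ (D.W⁻¹ *ᵥ ((-1 : ℝ) • (D.W *ᵥ x))) = - D.cn * normSqM D.M x := by
    rw [mulVec_smul, hD.lumped_posDef.inv_mulVec_mulVec, smul_dotProduct, dotProduct_smul,
      dotProduct_comm, normSqM]
    simp
  have h3 : normSqM D.D1 x
      = 1 / D.α * (D.cn * normSqM D.W⁻¹ (D.M *ᵥ x) - normSqM D.M x) := by
    simp only [normSqM, D1, sub_mulVec, smul_mulVec, dotProduct_sub, dotProduct_smul, smul_eq_mul,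
      ← mulVec_mulVec]
    rw [hD.mass_posDef.isSymm.dotProduct_mulVec_comm x (D.W⁻¹ *ᵥ (D.M *ᵥ x)),
      dotProduct_comm (D.W⁻¹ *ᵥ (D.M *ᵥ x))]
    ring
  have h4 := hD.lumped_le_mass x
  rw [h1, h2] at h0
  have h5 : 0 ≤ D.cn * (D.cn * normSqM D.W⁻¹ (D.M *ᵥ x) - normSqM D.M x) := by linarith
  rw [h3]
  exact mul_nonneg (by positivity) (nonneg_of_mul_nonneg_right h5 hc)

theorem IsAdmissible.D2lam_isSymm (hD : D.IsAdmissible) : D.D2lam.IsSymm := by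
  have hM := hD.mass_posDef.isSymm
  have h : (((1 / D.α) • D.M) * D.hessP⁻¹ * ((1 / D.α) • D.M)).IsSymm := by
    rw [IsSymm, transpose_mul, transpose_mul, transpose_nonsing_inv, (hM.smul _).eq,
      hD.hessP_posDef.isSymm.eq, Matrix.mul_assoc]
  exact h.add ((hD.lumped_posDef.isSymm.sub hM).smul _)

theorem IsAdmissible.normSqM_D2lam (hD : D.IsAdmissible) (x : Fin N → ℝ) :
    normSqM D.D2lam x = normSqM D.hessP⁻¹ (((1 / D.α) • D.M) *ᵥ x)
      + 1 / D.α * (normSqM D.W x - normSqM D.M x) := by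
  have hM : ((1 / D.α) • D.M).IsSymm := hD.mass_posDef.isSymm.smul _
  rw [normSqM, D2lam, add_mulVec, dotProduct_add, ← mulVec_mulVec, ← mulVec_mulVec,
    hM.dotProduct_mulVec_comm x, dotProduct_comm]
  simp only [normSqM, smul_mulVec, sub_mulVec, dotProduct_smul, dotProduct_sub, smul_eq_mul]

theorem IsAdmissible.normSqM_D2lam_nonneg (hD : D.IsAdmissible) (x : Fin N → ℝ) :
    0 ≤ normSqM D.D2lam x := by
  have hα := hD.α_pos
  rw [hD.normSqM_D2lam]
  have := hD.hessP_posDef.inv.normSqM_nonneg (((1 / D.α) • D.M) *ᵥ x)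
  have := mul_nonneg (one_div_pos.2 hα).le (sub_nonneg.2 (hD.mass_le_lumped x))
  linarith

theorem IsAdmissible.Q22_eq (hD : D.IsAdmissible) : D.Q22 = fromBlocks ((1 / D.α) • D.M)
    (-((1 / D.α) • D.M)) (-((1 / D.α) • D.M)) D.hessP := by
  have hα := hD.α_pos.ne'
  simp [Q22, hessP, KMK, fromBlocks_smul, smul_smul, hα]

theorem IsAdmissible.sGS_Q22 (hD : D.IsAdmissible) : sGS D.Q22 =
    fromBlocks (((1 / D.α) • D.M) * D.hessP⁻¹ * ((1 / D.α) • D.M)) 0 0 0 := by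
  have h1 : IsUnit ((1 / D.α) • D.M) :=
    (hD.mass_posDef.smul (one_div_pos.2 hD.α_pos)).isUnit
  have hM : ((1 / D.α) • D.M).IsSymm := hD.mass_posDef.isSymm.smul _
  rw [sGS, hD.Q22_eq, toBlocks_fromBlocks₁₁, toBlocks_fromBlocks₁₂, toBlocks_fromBlocks₂₂,
    inv_fromBlocks_zero₁₂_of_isUnit_iff _ _ _ (iff_of_true h1 hD.hessP_posDef.isUnit),
    fromBlocks_transpose, transpose_neg, hM.eq, fromBlocks_multiply, fromBlocks_multiply]
  simp

/-- The form of `S` in terms of the three components. -/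
theorem IsAdmissible.normSqM_S (hD : D.IsAdmissible) (x y z : Fin N → ℝ) :
    normSqM D.S (Sum.elim x (Sum.elim y z)) = normSqM D.D1 x + normSqM D.D2lam y
      + 1 / D.α * normSqM D.M (y - z) + normSqM D.KMK z := by
  have hM := hD.mass_posDef.isSymm
  rw [S, D2, hD.sGS_Q22, hD.Q22_eq, fromBlocks_smul, fromBlocks_add, fromBlocks_add]
  simp only [normSqM, fromBlocks_mulVec, Sum.elim_comp_inl, Sum.elim_comp_inr,
    sumElim_dotProduct_sumElim, zero_mulVec, add_zero, zero_add, smul_zero]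
  rw [← D2lam, hessP]
  simp only [add_mulVec, neg_mulVec, smul_mulVec, dotProduct_add, dotProduct_neg, dotProduct_smul,
    smul_eq_mul, mulVec_sub, dotProduct_sub, sub_dotProduct]
  rw [hM.dotProduct_mulVec_comm z y]
  ring

theorem IsAdmissible.normSqM_S_nonneg (hD : D.IsAdmissible)
    (v : Fin N ⊕ (Fin N ⊕ Fin N) → ℝ) : 0 ≤ normSqM D.S v := by
  have h := hD.normSqM_S (v ∘ Sum.inl) ((v ∘ Sum.inr) ∘ Sum.inl) ((v ∘ Sum.inr) ∘ Sum.inr)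
  rw [Sum.elim_comp_inl_inr, Sum.elim_comp_inl_inr] at h
  have hα := hD.α_pos
  have := hD.normSqM_D1_nonneg (v ∘ Sum.inl)
  have := hD.normSqM_D2lam_nonneg ((v ∘ Sum.inr) ∘ Sum.inl)
  have := mul_nonneg (one_div_pos.2 hα).le (hD.mass_posDef.normSqM_nonneg
    (((v ∘ Sum.inr) ∘ Sum.inl) - ((v ∘ Sum.inr) ∘ Sum.inr)))
  have := hD.normSqM_KMK_nonneg ((v ∘ Sum.inr) ∘ Sum.inr)
  linarith

/-! ### Variational inequalities of the four steps -/

theorem IsAdmissible.mu_step_variational (hD : D.IsAdmissible) {zk : DualVar N}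
    {δ u : Fin N → ℝ} (hu : IsArgmin (D.muObj zk δ) u) (w : Fin N → ℝ) :
    0 ≤ supportFun D.a D.b (D.M *ᵥ w) - supportFun D.a D.b (D.M *ᵥ u)
      + 1 / D.α * ((w - u) ⬝ᵥ (D.M *ᵥ (u - (zk.p - zk.lam))))
      + (w - u) ⬝ᵥ (D.D1 *ᵥ (u - zk.mu)) - δ ⬝ᵥ (w - u) := by
  have hα := hD.α_pos
  refine nonneg_of_forall_quadratic
    (h := 1 / (2 * D.α) * normSqM D.M (w - u) + 1 / 2 * normSqM D.D1 (w - u)) fun s hs0 hs1 => ?_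
  have h := hu (u + s • (w - u))
  have hf := supportFun_convex hD.a_le_b (D.M *ᵥ u) (D.M *ᵥ w) hs0.le hs1
  have e : D.M *ᵥ (u + s • (w - u)) = (1 - s) • (D.M *ᵥ u) + s • (D.M *ᵥ w) := by
    rw [mulVec_add, mulVec_smul, mulVec_sub]
    module
  simp only [muObj] at h
  rw [e, add_sub_right_comm u (s • (w - u)) (zk.p - zk.lam),
    add_sub_right_comm u (s • (w - u)) zk.mu,
    normSqM_add_smul hD.mass_posDef.isSymm, normSqM_add_smul hD.D1_isSymm, dotProduct_add,
    dotProduct_smul, smul_eq_mul] at h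
  have e2 : 1 / (2 * D.α) = 1 / 2 * (1 / D.α) := by field_simp
  rw [e2] at h ⊢
  linarith

theorem IsAdmissible.p_step_gradient (hD : D.IsAdmissible) {mu lam δ p : Fin N → ℝ}
    (hp : IsArgmin (D.pObj mu lam δ) p) :
    D.K *ᵥ (D.M⁻¹ *ᵥ (D.K *ᵥ p - D.M *ᵥ D.yd)) + (1 / D.α) • (D.M *ᵥ (p - lam - mu))
      + D.M *ᵥ D.yr = δ := by
  have hα := hD.α_pos
  have key : ∀ d : Fin N → ℝ, 0 ≤ d ⬝ᵥ (D.K *ᵥ (D.M⁻¹ *ᵥ (D.K *ᵥ p - D.M *ᵥ D.yd))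
      + (1 / D.α) • (D.M *ᵥ (p - lam - mu)) + D.M *ᵥ D.yr - δ) := by
    intro d
    refine nonneg_of_forall_quadratic
      (h := 1 / 2 * normSqM D.M⁻¹ (D.K *ᵥ d) + 1 / (2 * D.α) * normSqM D.M d) fun s _ _ => ?_
    have h := hp (p + s • d)
    have e1 : D.K *ᵥ (p + s • d) - D.M *ᵥ D.yd = (D.K *ᵥ p - D.M *ᵥ D.yd) + s • (D.K *ᵥ d) := by
      rw [mulVec_add, mulVec_smul]; abel
    have e2 : p + s • d - lam - mu + D.α • D.yr = (p - lam - mu + D.α • D.yr) + s • d := by abel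
    simp only [pObj] at h
    rw [e1, e2, normSqM_add_smul hD.mass_posDef.inv.isSymm,
      normSqM_add_smul hD.mass_posDef.isSymm (p - lam - mu + D.α • D.yr), mulVec_add, mulVec_smul,
      dotProduct_comm (D.K *ᵥ d), ← hD.stiffness_isSymm.dotProduct_mulVec_comm] at h
    simp only [dotProduct_add, dotProduct_sub, dotProduct_smul, smul_eq_mul] at h ⊢
    rw [dotProduct_comm δ d] at h
    have e3 : 1 / (2 * D.α) = 1 / 2 * (1 / D.α) := by field_simp
    have e4 : 1 / D.α * (D.α * (d ⬝ᵥ (D.M *ᵥ D.yr))) = d ⬝ᵥ (D.M *ᵥ D.yr) := by field_simp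
    rw [e3] at h ⊢
    linear_combination h + s * e4
  refine sub_eq_zero.1 (dotProduct_eq_zero _ fun d => le_antisymm ?_ ?_)
  · have := key (-d)
    rw [neg_dotProduct, dotProduct_comm] at this
    linarith
  · rw [dotProduct_comm]; exact key d

theorem lamObj_of_mem {mu phat lamk lam : Fin N → ℝ} (h : ∀ i, -D.β ≤ lam i ∧ lam i ≤ D.β) :
    D.lamObj mu phat lamk lam = ((1 / (2 * D.α) * normSqM D.M (lam - (phat - mu))
      + 1 / (2 * D.α) * normSqM (D.W - D.M) (lam - lamk) : ℝ) : EReal) := by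
  rw [lamObj, boxIndicator, if_pos h, add_zero]

theorem IsAdmissible.lam_step_mem (hD : D.IsAdmissible) {mu phat lamk l : Fin N → ℝ}
    (hl : IsArgmin (D.lamObj mu phat lamk) l) (i : Fin N) : -D.β ≤ l i ∧ l i ≤ D.β := by
  have hβ := hD.β_nonneg
  revert i
  by_contra hn
  have h := hl 0
  rw [lamObj_of_mem (lam := 0) (fun i => ⟨by simpa using hβ, by simpa using hβ⟩), lamObj, boxIndicator,
    if_neg hn, EReal.coe_add_top, top_le_iff] at h
  exact EReal.coe_ne_top _ h

theorem IsAdmissible.lam_step_variational (hD : D.IsAdmissible) {mu phat lamk l : Fin N → ℝ}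
    (hl : IsArgmin (D.lamObj mu phat lamk) l) {w : Fin N → ℝ}
    (hw : ∀ i, -D.β ≤ w i ∧ w i ≤ D.β) :
    0 ≤ 1 / D.α * ((w - l) ⬝ᵥ (D.M *ᵥ (l - (phat - mu))))
      + 1 / D.α * ((w - l) ⬝ᵥ ((D.W - D.M) *ᵥ (l - lamk))) := by
  have hα := hD.α_pos
  have hWM : (D.W - D.M).IsSymm := hD.lumped_posDef.isSymm.sub hD.mass_posDef.isSymm
  refine nonneg_of_forall_quadratic (h := 1 / (2 * D.α) * normSqM D.M (w - l)
    + 1 / (2 * D.α) * normSqM (D.W - D.M) (w - l)) fun s hs0 hs1 => ?_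
  have hb := hD.lam_step_mem hl
  have hs : ∀ i, -D.β ≤ (l + s • (w - l)) i ∧ (l + s • (w - l)) i ≤ D.β := fun i => by
    have e : (l + s • (w - l)) i = (1 - s) * l i + s * w i := by
      simp only [Pi.add_apply, Pi.smul_apply, Pi.sub_apply, smul_eq_mul]; ring
    have h1 := mul_le_mul_of_nonneg_left (hb i).1 (sub_nonneg.2 hs1)
    have h2 := mul_le_mul_of_nonneg_left (hb i).2 (sub_nonneg.2 hs1)
    have h3 := mul_le_mul_of_nonneg_left (hw i).1 hs0.le
    have h4 := mul_le_mul_of_nonneg_left (hw i).2 hs0.le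
    rw [e]
    constructor <;> linarith
  have h := hl (l + s • (w - l))
  rw [lamObj_of_mem hs, lamObj_of_mem hb, EReal.coe_le_coe_iff, add_sub_right_comm,
    add_sub_right_comm l (s • (w - l)) lamk, normSqM_add_smul hD.mass_posDef.isSymm,
    normSqM_add_smul hWM] at h
  have e2 : 1 / (2 * D.α) = 1 / 2 * (1 / D.α) := by field_simp
  rw [e2] at h ⊢
  linarith

/-! ### The one-step estimate -/

/-- The real-valued part of the dual objective, which agrees with it on the box. -/
noncomputable def objective (D : DualData N) (z : DualVar N) : ℝ :=
  D.smooth z + supportFun D.a D.b (D.M *ᵥ z.mu)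

theorem IsAdmissible.smooth_expand (hD : D.IsAdmissible) (w z : DualVar N) :
    D.smooth w = D.smooth z
      + (w.p - z.p) ⬝ᵥ (D.K *ᵥ (D.M⁻¹ *ᵥ (D.K *ᵥ z.p - D.M *ᵥ D.yd)))
      + 1 / 2 * normSqM D.KMK (w.p - z.p)
      + 1 / D.α * (((w.lam - z.lam) + (w.mu - z.mu) - (w.p - z.p)) ⬝ᵥ
          (D.M *ᵥ (z.lam + z.mu - z.p)))
      + 1 / (2 * D.α) * normSqM D.M ((w.lam - z.lam) + (w.mu - z.mu) - (w.p - z.p))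
      + (w.p - z.p) ⬝ᵥ (D.M *ᵥ D.yr) := by
  have hα := hD.α_pos
  have e1 : D.K *ᵥ w.p - D.M *ᵥ D.yd
      = (D.K *ᵥ z.p - D.M *ᵥ D.yd) + (1 : ℝ) • (D.K *ᵥ (w.p - z.p)) := by
    rw [mulVec_sub, one_smul]; abel
  have e2 : w.lam + w.mu - w.p = (z.lam + z.mu - z.p)
      + (1 : ℝ) • ((w.lam - z.lam) + (w.mu - z.mu) - (w.p - z.p)) := by
    rw [one_smul]; abel
  have e3 : (D.K *ᵥ (w.p - z.p)) ⬝ᵥ (D.M⁻¹ *ᵥ (D.K *ᵥ z.p - D.M *ᵥ D.yd))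
      = (w.p - z.p) ⬝ᵥ (D.K *ᵥ (D.M⁻¹ *ᵥ (D.K *ᵥ z.p - D.M *ᵥ D.yd))) := by
    rw [dotProduct_comm, hD.stiffness_isSymm.dotProduct_mulVec_comm]
  have e4 : 1 / (2 * D.α) = 1 / 2 * (1 / D.α) := by field_simp
  rw [smooth, smooth, e1, e2, normSqM_add_smul hD.mass_posDef.inv.isSymm,
    normSqM_add_smul hD.mass_posDef.isSymm, e3, ← hD.normSqM_KMK, e4, sub_dotProduct,
    sub_dotProduct w.p z.p (D.M *ᵥ D.yr), dotProduct_comm (D.M *ᵥ D.yr),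
    dotProduct_comm (D.M *ᵥ D.yr) z.p]
  ring

/-- The error of the `λ`-block that is caused by the inexact `p`-steps. -/
noncomputable def lamError (D : DualData N) (δphat δp : Fin N → ℝ) : Fin N → ℝ :=
  ((1 / D.α) • D.M) *ᵥ (D.hessP⁻¹ *ᵥ (δphat - δp))

/-- The two `p`-steps of a sweep differ by the increment of `λ` through the inverse Hessian; this is
where the symmetric Gauss-Seidel operator comes from. -/
theorem IsAdmissible.mass_mulVec_phat_sub (hD : D.IsAdmissible)
    {mu lamk lam δphat δp phat p : Fin N → ℝ} (h1 : IsArgmin (D.pObj mu lamk δphat) phat)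
    (h2 : IsArgmin (D.pObj mu lam δp) p) :
    ((1 / D.α) • D.M) *ᵥ (phat - p) + (1 / D.α) • ((D.W - D.M) *ᵥ (lamk - lam))
      = D.D2lam *ᵥ (lamk - lam) + D.lamError δphat δp := by
  have g1 := hD.p_step_gradient h1
  have g2 := hD.p_step_gradient h2
  have e : D.hessP *ᵥ (phat - p) = ((1 / D.α) • D.M) *ᵥ (lamk - lam) + (δphat - δp) := by
    rw [← g1, ← g2, hessP, KMK]
    simp only [add_mulVec, ← mulVec_mulVec, mulVec_sub, smul_mulVec, smul_sub]
    abel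
  have e2 : phat - p = D.hessP⁻¹ *ᵥ (((1 / D.α) • D.M) *ᵥ (lamk - lam) + (δphat - δp)) := by
    rw [← e, hD.hessP_posDef.inv_mulVec_mulVec]
  rw [e2, D2lam, lamError, add_mulVec, mulVec_add, mulVec_add, ← mulVec_mulVec, ← mulVec_mulVec,
    smul_mulVec _ (D.W - D.M)]
  abel

/-- One inexact sweep of the algorithm, compared with an arbitrary feasible point `w`. -/
theorem IsAdmissible.sweep_le (hD : D.IsAdmissible) {zk z : DualVar N}
    {phat δμ δphat δp : Fin N → ℝ} (hmu : IsArgmin (D.muObj zk δμ) z.mu)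
    (hphat : IsArgmin (D.pObj z.mu zk.lam δphat) phat)
    (hlam : IsArgmin (D.lamObj z.mu phat zk.lam) z.lam)
    (hp : IsArgmin (D.pObj z.mu z.lam δp) z.p) {w : DualVar N}
    (hw : ∀ i, -D.β ≤ w.lam i ∧ w.lam i ≤ D.β) :
    D.objective z + 1 / 2 * D.distSqS w z
      + 1 / (2 * D.α) * normSqM D.M ((w.mu - z.mu) + ((w.lam - zk.lam) - (w.p - zk.p)))
      + (δμ ⬝ᵥ (w.mu - z.mu) + D.lamError δphat δp ⬝ᵥ (w.lam - z.lam) + δp ⬝ᵥ (w.p - z.p))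
      ≤ D.objective w + 1 / 2 * D.distSqS w zk := by
  have hα := hD.α_pos
  have hM := hD.mass_posDef.isSymm
  have v1 := hD.mu_step_variational hmu w.mu
  have v2 := hD.lam_step_variational hlam hw
  have g : (w.p - z.p) ⬝ᵥ _ = (w.p - z.p) ⬝ᵥ _ :=
    congrArg ((w.p - z.p) ⬝ᵥ ·) (hD.p_step_gradient hp)
  have q : (w.lam - z.lam) ⬝ᵥ _ = (w.lam - z.lam) ⬝ᵥ _ :=
    congrArg ((w.lam - z.lam) ⬝ᵥ ·) (hD.mass_mulVec_phat_sub hphat hp)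
  have ex := hD.smooth_expand w z
  have n1 := hD.normSqM_D1_nonneg (z.mu - zk.mu)
  have n2 := hD.normSqM_D2lam_nonneg (z.lam - zk.lam)
  have n3 := hD.normSqM_KMK_nonneg (w.p - zk.p)
  have d1 : w.mu - zk.mu = (w.mu - z.mu) + (z.mu - zk.mu) := by abel
  have d2 : w.lam - zk.lam = (w.lam - z.lam) + (z.lam - zk.lam) := by abel
  have d4 : zk.lam - z.lam = -(z.lam - zk.lam) := by abel
  have d5 : z.mu - (zk.p - zk.lam) = (z.lam + z.mu - z.p) - ((z.lam - zk.lam) - (z.p - zk.p)) := by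
    abel
  have d6 : z.lam - (phat - z.mu) = (z.lam + z.mu - z.p) - (phat - z.p) := by abel
  have d7 : z.p - z.lam - z.mu = -(z.lam + z.mu - z.p) := by abel
  have d8 : w.lam - zk.lam - (w.p - zk.p)
      = ((w.lam - z.lam) - (w.p - z.p)) + ((z.lam - zk.lam) - (z.p - zk.p)) := by abel
  have d9 : w.lam - z.lam + (w.mu - z.mu) - (w.p - z.p)
      = (w.mu - z.mu) + ((w.lam - z.lam) - (w.p - z.p)) := by abel
  rw [objective, objective, distSqS, distSqS, hD.normSqM_S, hD.normSqM_S, ex, d8, d9]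
  rw [d5] at v1
  rw [d6] at v2
  rw [d7] at g
  rw [d4] at q
  rw [d1, normSqM_add hD.D1_isSymm, d2, normSqM_add hD.D2lam_isSymm]
  -- from here on every term is bilinear in the displacements
  generalize z.lam + z.mu - z.p = r at *
  generalize w.mu - z.mu = dm at *
  generalize w.lam - z.lam = dl at *
  generalize w.p - z.p = dp at *
  generalize z.mu - zk.mu = em at *
  generalize z.lam - zk.lam = el at *
  generalize z.p - zk.p = ep at *
  generalize phat - z.p = ph at *
  have e1 : normSqM D.M (dm + (dl - dp + (el - ep))) = normSqM D.M dm
      + 2 * (dm ⬝ᵥ (D.M *ᵥ (dl - dp))) + 2 * (dm ⬝ᵥ (D.M *ᵥ (el - ep)))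
      + normSqM D.M (dl - dp + (el - ep)) := by
    rw [normSqM_add hM dm, mulVec_add D.M (dl - dp), dotProduct_add]
    ring
  have e2 : normSqM D.M (dm + (dl - dp)) = normSqM D.M dm
      + 2 * (dm ⬝ᵥ (D.M *ᵥ (dl - dp))) + normSqM D.M (dl - dp) := normSqM_add hM _ _
  have e3 : 1 / (2 * D.α) = 1 / 2 * (1 / D.α) := by field_simp
  rw [e1, e2, e3, dotProduct_comm δμ, dotProduct_comm (D.lamError _ _), dotProduct_comm δp]
  rw [dotProduct_comm δμ] at v1
  simp only [mulVec_sub D.M r, mulVec_neg, dotProduct_neg, smul_mulVec, dotProduct_add,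
    dotProduct_smul, smul_eq_mul, dotProduct_sub dm (D.M *ᵥ r), dotProduct_sub dl (D.M *ᵥ r),
    mul_neg] at v1 v2 g q
  have e4 : (dm + (dl - dp)) ⬝ᵥ (D.M *ᵥ r)
      = dm ⬝ᵥ (D.M *ᵥ r) + dl ⬝ᵥ (D.M *ᵥ r) - dp ⬝ᵥ (D.M *ᵥ r) := by
    rw [add_dotProduct, sub_dotProduct]; ring
  rw [e4]
  linarith

end DualData

/-! ### Bounds in the Euclidean norm -/

theorem exists_norm_le_sqrt_normSqM {ι : Type*} [Fintype ι] {A : Matrix ι ι ℝ}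
    (hA : ∀ x, x ≠ 0 → 0 < normSqM A x) :
    ∃ κ : ℝ, 0 ≤ κ ∧ ∀ x, ‖WithLp.toLp 2 x‖ ≤ κ * √(normSqM A x) := by
  have hcont : Continuous fun v : EuclideanSpace ℝ ι => normSqM A v.ofLp := by
    unfold normSqM
    fun_prop
  obtain ⟨m, hm, hmv⟩ : ∃ m : ℝ, 0 < m ∧ ∀ v ∈ Metric.sphere (0 : EuclideanSpace ℝ ι) 1,
      m ≤ normSqM A v.ofLp := by
    rcases (Metric.sphere (0 : EuclideanSpace ℝ ι) 1).eq_empty_or_nonempty with he | hne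
    · exact ⟨1, one_pos, by simp [he]⟩
    · obtain ⟨v, hv, hmin⟩ := (isCompact_sphere (0 : EuclideanSpace ℝ ι) 1).exists_isMinOn hne
        hcont.continuousOn
      refine ⟨_, hA v.ofLp fun h0 => ?_, hmin⟩
      have : v = 0 := by ext i; simpa using congrFun h0 i
      simp [this] at hv
  refine ⟨(√m)⁻¹, by positivity, fun x => ?_⟩
  rw [inv_mul_eq_div, le_div_iff₀ (Real.sqrt_pos.2 hm)]
  refine Real.le_sqrt_of_sq_le ?_
  rw [mul_pow, Real.sq_sqrt hm.le]
  by_cases hx : x = 0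
  · simp [hx, normSqM]
  have hn : 0 < ‖WithLp.toLp 2 x‖ := norm_pos_iff.2 (by simpa using hx)
  have h := hmv (‖WithLp.toLp 2 x‖⁻¹ • WithLp.toLp 2 x) (by simp [norm_smul, hn.ne'])
  rw [WithLp.ofLp_smul, normSqM_smul, inv_pow, inv_mul_eq_div, le_div_iff₀ (by positivity)] at h
  linarith

theorem dotProduct_le_norm_mul_norm {ι : Type*} [Fintype ι] (x y : ι → ℝ) :
    x ⬝ᵥ y ≤ ‖WithLp.toLp 2 x‖ * ‖WithLp.toLp 2 y‖ := by
  refine le_trans (le_of_eq ?_) (real_inner_le_norm (WithLp.toLp 2 x) (WithLp.toLp 2 y))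
  rw [EuclideanSpace.inner_toLp_toLp, star_trivial, dotProduct_comm]

theorem exists_norm_mulVec_le {ι : Type*} [Fintype ι] [DecidableEq ι] (A : Matrix ι ι ℝ) :
    ∃ L : ℝ, 0 ≤ L ∧ ∀ x, ‖WithLp.toLp 2 (A *ᵥ x)‖ ≤ L * ‖WithLp.toLp 2 x‖ :=
  ⟨‖toEuclideanCLM (𝕜 := ℝ) A‖, norm_nonneg _, fun x =>
    (toEuclideanCLM (𝕜 := ℝ) A).le_opNorm (WithLp.toLp 2 x)⟩

namespace DualData

variable {N : ℕ} {D : DualData N}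

/-- `C` bounds the pairing of the error vectors with a displacement `(x, y, z)` by the `S`-norms of
this displacement and of the preceding one, `(x', y', z')`.  The matrix `D₁` may be singular, so the
component `x` is not controlled by the `S`-norm of `(x, y, z)`; the last summand makes up for it. -/
def HasErrorBound (D : DualData N) (C : ℝ) : Prop :=
  ∀ (e : ℝ) (δμ δphat δp : Fin N → ℝ), ‖WithLp.toLp 2 δμ‖ ≤ e → ‖WithLp.toLp 2 δphat‖ ≤ e →
    ‖WithLp.toLp 2 δp‖ ≤ e → ∀ x y z x' y' z' : Fin N → ℝ,
    δμ ⬝ᵥ x + D.lamError δphat δp ⬝ᵥ y + δp ⬝ᵥ z ≤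
      C * e * (√(1 / 2 * normSqM D.S (Sum.elim x (Sum.elim y z)))
        + √(1 / 2 * normSqM D.S (Sum.elim x' (Sum.elim y' z')))
        + √(1 / (2 * D.α) * normSqM D.M (x + (y' - z'))))

theorem IsAdmissible.normSqM_D2lam_pos (hD : D.IsAdmissible) {x : Fin N → ℝ} (hx : x ≠ 0) :
    0 < normSqM D.D2lam x := by
  have hα := one_div_pos.2 hD.α_pos
  have hM : ((1 / D.α) • D.M).PosDef := hD.mass_posDef.smul hα
  rw [hD.normSqM_D2lam]
  have h0 : ((1 / D.α) • D.M) *ᵥ x ≠ 0 := fun h => hx <| by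
    rw [← hM.inv_mulVec_mulVec x, h, mulVec_zero]
  have h1 : 0 < normSqM D.hessP⁻¹ (((1 / D.α) • D.M) *ᵥ x) := by
    simpa [normSqM] using hD.hessP_posDef.inv.dotProduct_mulVec_pos h0
  have := mul_nonneg hα.le (sub_nonneg.2 (hD.mass_le_lumped x))
  linarith

/-- The `S`-norm controls the components `λ` and `p`. -/
theorem IsAdmissible.exists_norm_le_sqrt_normSqM_S (hD : D.IsAdmissible) :
    ∃ κ : ℝ, 0 ≤ κ ∧
      (∀ x y z : Fin N → ℝ,
        ‖WithLp.toLp 2 y‖ ≤ κ * √(1 / 2 * normSqM D.S (Sum.elim x (Sum.elim y z))) ∧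
        ‖WithLp.toLp 2 z‖ ≤ κ * √(1 / 2 * normSqM D.S (Sum.elim x (Sum.elim y z)))) ∧
      ∀ v, ‖WithLp.toLp 2 v‖ ≤ κ * √(1 / (2 * D.α) * normSqM D.M v) := by
  have hα := hD.α_pos
  obtain ⟨κ₁, hκ₁, h₁⟩ := exists_norm_le_sqrt_normSqM (A := (1 / 2 : ℝ) • D.D2lam) fun x hx => by
    have := hD.normSqM_D2lam_pos hx
    simp only [normSqM, smul_mulVec, dotProduct_smul, smul_eq_mul] at this ⊢
    positivity
  obtain ⟨κ₂, hκ₂, h₂⟩ := exists_norm_le_sqrt_normSqM (A := (1 / (2 * D.α)) • D.M) fun x hx => by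
    have : 0 < x ⬝ᵥ (D.M *ᵥ x) := by simpa using hD.mass_posDef.dotProduct_mulVec_pos hx
    simp only [normSqM, smul_mulVec, dotProduct_smul, smul_eq_mul]
    positivity
  have e₁ : ∀ x, normSqM ((1 / 2 : ℝ) • D.D2lam) x = 1 / 2 * normSqM D.D2lam x := fun x => by
    simp only [normSqM, smul_mulVec, dotProduct_smul, smul_eq_mul]
  have e₂ : ∀ x, normSqM ((1 / (2 * D.α)) • D.M) x = 1 / (2 * D.α) * normSqM D.M x := fun x => by
    simp only [normSqM, smul_mulVec, dotProduct_smul, smul_eq_mul]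
  simp only [e₁] at h₁
  simp only [e₂] at h₂
  refine ⟨κ₁ + κ₂, by positivity, fun x y z => ?_, fun v => (h₂ v).trans
    (mul_le_mul_of_nonneg_right (by linarith) (Real.sqrt_nonneg _))⟩
  have hS := hD.normSqM_S x y z
  have n1 := hD.normSqM_D1_nonneg x
  have n2 := hD.normSqM_D2lam_nonneg y
  have n3 := mul_nonneg (one_div_pos.2 hα).le (hD.mass_posDef.normSqM_nonneg (y - z))
  have n4 := hD.normSqM_KMK_nonneg z
  have e3 : 1 / (2 * D.α) = 1 / 2 * (1 / D.α) := by field_simp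
  set s := √(1 / 2 * normSqM D.S (Sum.elim x (Sum.elim y z))) with hs
  have hs0 : 0 ≤ s := Real.sqrt_nonneg _
  have hy : ‖WithLp.toLp 2 y‖ ≤ κ₁ * s :=
    (h₁ y).trans (mul_le_mul_of_nonneg_left (Real.sqrt_le_sqrt (by linarith)) hκ₁)
  have hyz : ‖WithLp.toLp 2 (y - z)‖ ≤ κ₂ * s :=
    (h₂ _).trans (mul_le_mul_of_nonneg_left (Real.sqrt_le_sqrt (by rw [e3]; linarith)) hκ₂)
  have hz : ‖WithLp.toLp 2 z‖ ≤ ‖WithLp.toLp 2 y‖ + ‖WithLp.toLp 2 (y - z)‖ := by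
    have : WithLp.toLp 2 z = WithLp.toLp 2 y - WithLp.toLp 2 (y - z) := by
      rw [WithLp.toLp_sub]; abel
    rw [this]
    exact norm_sub_le _ _
  have := mul_nonneg hκ₂ hs0
  constructor <;> linarith

theorem IsAdmissible.exists_hasErrorBound (hD : D.IsAdmissible) :
    ∃ C : ℝ, 0 ≤ C ∧ D.HasErrorBound C := by
  obtain ⟨κ, hκ, hyz, hv⟩ := hD.exists_norm_le_sqrt_normSqM_S
  obtain ⟨L, hL, hLn⟩ := exists_norm_mulVec_le (((1 / D.α) • D.M) * D.hessP⁻¹)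
  refine ⟨κ * (2 + 2 * L), by positivity, fun e δμ δphat δp h1 h2 h3 x y z x' y' z' => ?_⟩
  have he : 0 ≤ e := (norm_nonneg _).trans h1
  obtain ⟨hy, hz⟩ := hyz x y z
  obtain ⟨hy', hz'⟩ := hyz x' y' z'
  have hx := hv (x + (y' - z'))
  set s := √(1 / 2 * normSqM D.S (Sum.elim x (Sum.elim y z)))
  set s' := √(1 / 2 * normSqM D.S (Sum.elim x' (Sum.elim y' z')))
  set r := √(1 / (2 * D.α) * normSqM D.M (x + (y' - z')))
  have hs : 0 ≤ s := Real.sqrt_nonneg _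
  have hs' : 0 ≤ s' := Real.sqrt_nonneg _
  have hr : 0 ≤ r := Real.sqrt_nonneg _
  have hxn : ‖WithLp.toLp 2 x‖ ≤ κ * r + 2 * (κ * s') := by
    have : WithLp.toLp 2 x
        = WithLp.toLp 2 (x + (y' - z')) - (WithLp.toLp 2 y' - WithLp.toLp 2 z') := by
      rw [WithLp.toLp_add, WithLp.toLp_sub]; abel
    rw [this]
    have := norm_sub_le (WithLp.toLp 2 (x + (y' - z'))) (WithLp.toLp 2 y' - WithLp.toLp 2 z')
    have := norm_sub_le (WithLp.toLp 2 y') (WithLp.toLp 2 z')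
    linarith
  have hE : ‖WithLp.toLp 2 (D.lamError δphat δp)‖ ≤ L * (2 * e) := by
    rw [lamError, mulVec_mulVec]
    refine (hLn _).trans (mul_le_mul_of_nonneg_left ?_ hL)
    rw [WithLp.toLp_sub]
    have := norm_sub_le (WithLp.toLp 2 δphat) (WithLp.toLp 2 δp)
    linarith
  have p1 : δμ ⬝ᵥ x ≤ e * (κ * r + 2 * (κ * s')) := (dotProduct_le_norm_mul_norm _ _).trans
    (mul_le_mul h1 hxn (norm_nonneg _) he)
  have p2 : D.lamError δphat δp ⬝ᵥ y ≤ L * (2 * e) * (κ * s) :=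
    (dotProduct_le_norm_mul_norm _ _).trans (mul_le_mul hE hy (norm_nonneg _) (by positivity))
  have p3 : δp ⬝ᵥ z ≤ e * (κ * s) := (dotProduct_le_norm_mul_norm _ _).trans
    (mul_le_mul h3 hz (norm_nonneg _) he)
  have q1 : 0 ≤ κ * e * s := by positivity
  have q2 : 0 ≤ κ * e * r := by positivity
  have q3 : 0 ≤ L * (κ * e * s') := by positivity
  have q4 : 0 ≤ L * (κ * e * r) := by positivity
  linarith

/-! ### Convexity and minimality -/

theorem normSqM_convex {ι : Type*} [Fintype ι] {A : Matrix ι ι ℝ} (hA : A.PosDef) (x y : ι → ℝ)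
    {s : ℝ} (h0 : 0 ≤ s) (h1 : s ≤ 1) :
    normSqM A ((1 - s) • x + s • y) ≤ (1 - s) * normSqM A x + s * normSqM A y := by
  have e1 : (1 - s) • x + s • y = x + s • (y - x) := by module
  have e2 := normSqM_add_smul hA.isSymm x (y - x) 1
  rw [one_smul, add_sub_cancel] at e2
  rw [e1, normSqM_add_smul hA.isSymm, e2]
  have := mul_nonneg (mul_nonneg h0 (sub_nonneg.2 h1)) (hA.normSqM_nonneg (y - x))
  linarith

theorem IsAdmissible.objective_convex (hD : D.IsAdmissible) {x y w : DualVar N} {s : ℝ}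
    (h0 : 0 ≤ s) (h1 : s ≤ 1) (hmu : w.mu = (1 - s) • x.mu + s • y.mu)
    (hlam : w.lam = (1 - s) • x.lam + s • y.lam) (hp : w.p = (1 - s) • x.p + s • y.p) :
    D.objective w ≤ (1 - s) * D.objective x + s * D.objective y := by
  have hα := hD.α_pos
  have e1 : D.K *ᵥ w.p - D.M *ᵥ D.yd
      = (1 - s) • (D.K *ᵥ x.p - D.M *ᵥ D.yd) + s • (D.K *ᵥ y.p - D.M *ᵥ D.yd) := by
    rw [hp, mulVec_add, mulVec_smul, mulVec_smul]; module
  have e2 : w.lam + w.mu - w.p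
      = (1 - s) • (x.lam + x.mu - x.p) + s • (y.lam + y.mu - y.p) := by
    rw [hp, hlam, hmu]; module
  have c1 := normSqM_convex hD.mass_posDef.inv (D.K *ᵥ x.p - D.M *ᵥ D.yd)
    (D.K *ᵥ y.p - D.M *ᵥ D.yd) h0 h1
  have c2 := mul_le_mul_of_nonneg_left (normSqM_convex hD.mass_posDef (x.lam + x.mu - x.p)
    (y.lam + y.mu - y.p) h0 h1) (show 0 ≤ 1 / (2 * D.α) by positivity)
  have c3 := supportFun_convex hD.a_le_b (D.M *ᵥ x.mu) (D.M *ᵥ y.mu) h0 h1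
  simp only [objective, smooth]
  rw [e1, e2, hmu, mulVec_add, mulVec_smul, mulVec_smul, hp, dotProduct_add, dotProduct_smul,
    dotProduct_smul, smul_eq_mul, smul_eq_mul]
  linarith

theorem Phi_of_mem {z : DualVar N} (h : ∀ i, -D.β ≤ z.lam i ∧ z.lam i ≤ D.β) :
    D.Phi z = (D.objective z : EReal) := by
  rw [Phi, boxIndicator, if_pos h, add_zero, objective]

theorem IsSolution.lam_mem (hD : D.IsAdmissible) {z : DualVar N} (hz : D.IsSolution z) (i : Fin N) :
    -D.β ≤ z.lam i ∧ z.lam i ≤ D.β := by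
  have hβ := hD.β_nonneg
  revert i
  by_contra hn
  have h := hz ⟨0, 0, 0⟩
  rw [Phi_of_mem (z := ⟨0, 0, 0⟩) (fun i => ⟨by simpa using hβ, by simpa using hβ⟩), Phi,
    boxIndicator, if_neg hn, EReal.coe_add_top, top_le_iff] at h
  exact EReal.coe_ne_top _ h

theorem IsSolution.objective_le (hD : D.IsAdmissible) {z w : DualVar N} (hz : D.IsSolution z)
    (hw : ∀ i, -D.β ≤ w.lam i ∧ w.lam i ≤ D.β) : D.objective z ≤ D.objective w := by
  have h := hz w
  rwa [Phi_of_mem (hz.lam_mem hD), Phi_of_mem hw, EReal.coe_le_coe_iff] at h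

/-! ### Acceleration -/

namespace Run

variable {ε : ℕ → ℝ} (run : D.Run ε)

theorem t_ge {k : ℕ} (hk : 1 ≤ k) : ((k : ℝ) + 1) / 2 ≤ run.t k := by
  induction k, hk using Nat.le_induction with
  | base => rw [run.t_one]; norm_num
  | succ k hk ih =>
    rw [run.t_succ k hk]
    have h1 : 2 * run.t k ≤ √(1 + 4 * run.t k ^ 2) := Real.le_sqrt_of_sq_le (by nlinarith)
    push_cast
    linarith

theorem one_le_t {k : ℕ} (hk : 1 ≤ k) : 1 ≤ run.t k := by
  have h1 := run.t_ge hk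
  have h2 : (1 : ℝ) ≤ k := by exact_mod_cast hk
  linarith

theorem t_le {k : ℕ} (hk : 1 ≤ k) : run.t k ≤ k := by
  induction k, hk using Nat.le_induction with
  | base => rw [run.t_one]; norm_num
  | succ k hk ih =>
    rw [run.t_succ k hk]
    have h0 := run.one_le_t hk
    have h1 : √(1 + 4 * run.t k ^ 2) ≤ 1 + 2 * run.t k :=
      Real.sqrt_le_iff.2 ⟨by linarith, by nlinarith⟩
    push_cast
    linarith

theorem t_succ_sq_sub {k : ℕ} (hk : 1 ≤ k) :
    run.t (k + 1) ^ 2 - run.t (k + 1) = run.t k ^ 2 := by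
  have h := Real.sq_sqrt (show 0 ≤ 1 + 4 * run.t k ^ 2 by positivity)
  rw [run.t_succ k hk]
  linear_combination h / 4

theorem lam_mem (hD : D.IsAdmissible) (k : ℕ) (i : Fin N) :
    -D.β ≤ (run.zt k).lam i ∧ (run.zt k).lam i ≤ D.β := by
  rcases Nat.eq_zero_or_pos k with rfl | hk
  · exact run.init_mem i
  · exact hD.lam_step_mem (run.lam_step k hk) i

/-- The displacement `tₖ zᵏ - (tₖ - 1) z̃ᵏ⁻¹ - z*` of the accelerated scheme, in the component `f`.
For `k = 1` it is `z̃⁰ - z*`. -/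
def disp (f : DualVar N → Fin N → ℝ) (zs : DualVar N) (k : ℕ) : Fin N → ℝ :=
  run.t k • f (run.z k) - (run.t k - 1) • f (run.zt (k - 1)) - f zs

theorem disp_one (f : DualVar N → Fin N → ℝ) (zs : DualVar N) :
    run.disp f zs 1 = f (run.zt 0) - f zs := by
  simp [disp, run.t_one, run.z_one]

/-- The extrapolation step is designed such that the next displacement is the one that the current
iterate produces in place of the extrapolated point. -/
theorem disp_succ {f : DualVar N → Fin N → ℝ} {k : ℕ}
    (hf : f (run.z (k + 1))
      = f (run.zt k) + ((run.t k - 1) / run.t (k + 1)) • (f (run.zt k) - f (run.zt (k - 1))))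
    (zs : DualVar N) : run.disp f zs (k + 1)
      = run.t k • f (run.zt k) - (run.t k - 1) • f (run.zt (k - 1)) - f zs := by
  have ht : run.t (k + 1) ≠ 0 := by have := run.one_le_t (Nat.le_add_left 1 k); positivity
  rw [disp, hf, Nat.add_sub_cancel, smul_add, smul_smul, mul_div_cancel₀ _ ht]
  module

/-- The squared `S`-norm of the displacement. -/
noncomputable def dispSq (zs : DualVar N) (k : ℕ) : ℝ :=
  normSqM D.S (Sum.elim (run.disp DualVar.mu zs k)
    (Sum.elim (run.disp DualVar.lam zs k) (run.disp DualVar.p zs k)))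

/-- The Lyapunov function of the accelerated scheme. -/
noncomputable def energy (zs : DualVar N) (k : ℕ) : ℝ :=
  (run.t k ^ 2 - run.t k) * (D.objective (run.zt (k - 1)) - D.objective zs)
    + 1 / 2 * run.dispSq zs k

theorem energy_one (zs : DualVar N) : run.energy zs 1 = 1 / 2 * D.distSqS (run.zt 0) zs := by
  simp [energy, run.t_one, dispSq, disp_one, distSqS]

theorem dispSq_le_energy (hD : D.IsAdmissible) {zs : DualVar N} (hzs : D.IsSolution zs) {k : ℕ}
    (hk : 1 ≤ k) : 1 / 2 * run.dispSq zs k ≤ run.energy zs k := by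
  have h1 := run.one_le_t hk
  have h2 := sub_nonneg.2 (hzs.objective_le hD (run.lam_mem hD (k - 1)))
  have h3 : 0 ≤ run.t k ^ 2 - run.t k := by nlinarith
  have := mul_nonneg h3 h2
  rw [energy]
  linarith

/-- The energy decreases up to the pairing of the errors with the displacement.  This is the
one-step estimate at the convex combination of the previous iterate and the solution. -/
theorem energy_succ_le (hD : D.IsAdmissible) {zs : DualVar N} (hzs : D.IsSolution zs) {k : ℕ}
    (hk : 1 ≤ k) :
    run.energy zs (k + 1) + 1 / (2 * D.α) * normSqM D.M (run.disp DualVar.mu zs (k + 1)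
        + (run.disp DualVar.lam zs k - run.disp DualVar.p zs k))
      ≤ run.energy zs k + run.t k * (run.δμ k ⬝ᵥ run.disp DualVar.mu zs (k + 1)
        + D.lamError (run.δphat k) (run.δp k) ⬝ᵥ run.disp DualVar.lam zs (k + 1)
        + run.δp k ⬝ᵥ run.disp DualVar.p zs (k + 1)) := by
  have ht := run.one_le_t hk
  have ht0 : run.t k ≠ 0 := by positivity
  have hs0 : 0 ≤ (run.t k)⁻¹ := by positivity
  have hs1 : (run.t k)⁻¹ ≤ 1 := inv_le_one_of_one_le₀ ht
  -- the comparison point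
  let w : DualVar N :=
    ⟨(1 - (run.t k)⁻¹) • (run.zt (k - 1)).mu + (run.t k)⁻¹ • zs.mu,
      (1 - (run.t k)⁻¹) • (run.zt (k - 1)).lam + (run.t k)⁻¹ • zs.lam,
      (1 - (run.t k)⁻¹) • (run.zt (k - 1)).p + (run.t k)⁻¹ • zs.p⟩
  have hw : ∀ i, -D.β ≤ w.lam i ∧ w.lam i ≤ D.β := fun i => by
    obtain ⟨h1, h2⟩ := run.lam_mem hD (k - 1) i
    obtain ⟨h3, h4⟩ := hzs.lam_mem hD i
    have a1 := mul_le_mul_of_nonneg_left h1 (sub_nonneg.2 hs1)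
    have a2 := mul_le_mul_of_nonneg_left h2 (sub_nonneg.2 hs1)
    have a3 := mul_le_mul_of_nonneg_left h3 hs0
    have a4 := mul_le_mul_of_nonneg_left h4 hs0
    simp only [w, Pi.add_apply, Pi.smul_apply, smul_eq_mul]
    constructor <;> linarith
  have hconv := hD.objective_convex (w := w) (x := run.zt (k - 1)) (y := zs) hs0 hs1 rfl rfl rfl
  have hsweep := hD.sweep_le (run.mu_step k hk) (run.phat_step k hk) (run.lam_step k hk)
    (run.p_step k hk) hw
  have key : ∀ a b c d : Fin N → ℝ, d = (1 - (run.t k)⁻¹) • a + (run.t k)⁻¹ • b →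
      d - c = (-(run.t k)⁻¹) • (run.t k • c - (run.t k - 1) • a - b) := by
    rintro a b c d rfl
    have : (run.t k)⁻¹ * (run.t k - 1) = 1 - (run.t k)⁻¹ := by field_simp
    rw [smul_sub, smul_sub, smul_smul, smul_smul, neg_mul, neg_mul, inv_mul_cancel₀ ht0, this]
    module
  have m1 : w.mu - (run.zt k).mu = (-(run.t k)⁻¹) • run.disp DualVar.mu zs (k + 1) := by
    rw [run.disp_succ (run.mu_succ k hk)]; exact key _ _ _ _ rfl
  have m2 : w.lam - (run.zt k).lam = (-(run.t k)⁻¹) • run.disp DualVar.lam zs (k + 1) := by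
    rw [run.disp_succ (run.lam_succ k hk)]; exact key _ _ _ _ rfl
  have m3 : w.p - (run.zt k).p = (-(run.t k)⁻¹) • run.disp DualVar.p zs (k + 1) := by
    rw [run.disp_succ (run.p_succ k hk)]; exact key _ _ _ _ rfl
  have n1 : w.mu - (run.z k).mu = (-(run.t k)⁻¹) • run.disp DualVar.mu zs k := key _ _ _ _ rfl
  have n2 : w.lam - (run.z k).lam = (-(run.t k)⁻¹) • run.disp DualVar.lam zs k := key _ _ _ _ rfl
  have n3 : w.p - (run.z k).p = (-(run.t k)⁻¹) • run.disp DualVar.p zs k := key _ _ _ _ rfl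
  have helim : ∀ (s : ℝ) (x y z : Fin N → ℝ), Sum.elim (s • x) (Sum.elim (s • y) (s • z))
      = s • Sum.elim x (Sum.elim y z) := fun s x y z => by
    ext (i | i | i) <;> rfl
  rw [distSqS, distSqS, m1, m2, m3, n1, n2, n3, helim, helim, ← smul_sub, ← smul_add,
    normSqM_smul, normSqM_smul, normSqM_smul, ← dispSq, ← dispSq, dotProduct_smul,
    dotProduct_smul, dotProduct_smul] at hsweep
  simp only [smul_eq_mul, neg_sq] at hsweep
  rw [energy, energy, run.t_succ_sq_sub hk, Nat.add_sub_cancel]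
  have hmul := mul_le_mul_of_nonneg_left (hsweep.trans (add_le_add_left hconv _))
    (sq_nonneg (run.t k))
  have c1 : run.t k ^ 2 * (run.t k)⁻¹ ^ 2 = 1 := by field_simp
  have c2 : run.t k ^ 2 * (run.t k)⁻¹ = run.t k := by field_simp
  linear_combination hmul - (1 / 2 * run.dispSq zs (k + 1)
      + 1 / (2 * D.α) * normSqM D.M (run.disp DualVar.mu zs (k + 1)
        + (run.disp DualVar.lam zs k - run.disp DualVar.p zs k)) - 1 / 2 * run.dispSq zs k) * c1
    + (run.δμ k ⬝ᵥ run.disp DualVar.mu zs (k + 1)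
        + D.lamError (run.δphat k) (run.δp k) ⬝ᵥ run.disp DualVar.lam zs (k + 1)
        + run.δp k ⬝ᵥ run.disp DualVar.p zs (k + 1)
        - D.objective (run.zt (k - 1)) + D.objective zs) * c2

/-- The square root of the energy grows by at most a multiple of `k εₖ` per step. -/
theorem sqrt_energy_succ_le (hD : D.IsAdmissible) {C : ℝ} (hC0 : 0 ≤ C) (hC : D.HasErrorBound C)
    {zs : DualVar N} (hzs : D.IsSolution zs) {k : ℕ} (hk : 1 ≤ k) :
    √(run.energy zs (k + 1)) ≤ √(run.energy zs k) + 2 * C * (k * ε k) := by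
  have hα := hD.α_pos
  have hε : 0 ≤ ε k := (norm_nonneg _).trans (run.norm_δμ k hk)
  have ht := run.one_le_t hk
  have hstep := run.energy_succ_le hD hzs hk
  have hbd := hC (ε k) _ _ _ (run.norm_δμ k hk) (run.norm_δphat k hk) (run.norm_δp k hk)
    (run.disp DualVar.mu zs (k + 1)) (run.disp DualVar.lam zs (k + 1))
    (run.disp DualVar.p zs (k + 1)) (run.disp DualVar.mu zs k) (run.disp DualVar.lam zs k)
    (run.disp DualVar.p zs k)
  rw [← dispSq, ← dispSq] at hbd
  have hr : 0 ≤ 1 / (2 * D.α) * normSqM D.M (run.disp DualVar.mu zs (k + 1)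
      + (run.disp DualVar.lam zs k - run.disp DualVar.p zs k)) :=
    mul_nonneg (by positivity) (hD.mass_posDef.normSqM_nonneg _)
  generalize 1 / (2 * D.α) * normSqM D.M (run.disp DualVar.mu zs (k + 1)
      + (run.disp DualVar.lam zs k - run.disp DualVar.p zs k)) = r at *
  have e1 := run.dispSq_le_energy hD hzs (Nat.le_add_left 1 k)
  have e2 := run.dispSq_le_energy hD hzs hk
  have d1 : 0 ≤ run.dispSq zs (k + 1) := hD.normSqM_S_nonneg _
  have d2 : 0 ≤ run.dispSq zs k := hD.normSqM_S_nonneg _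
  set X := √(run.energy zs (k + 1) + r)
  set Y := √(run.energy zs k)
  have hX : X ^ 2 = run.energy zs (k + 1) + r := Real.sq_sqrt (by linarith)
  have hY : Y ^ 2 = run.energy zs k := Real.sq_sqrt (by linarith)
  have hX0 : 0 ≤ X := Real.sqrt_nonneg _
  have hY0 : 0 ≤ Y := Real.sqrt_nonneg _
  have s1 : √(1 / 2 * run.dispSq zs (k + 1)) ≤ X := Real.sqrt_le_sqrt (by linarith)
  have s2 : √(1 / 2 * run.dispSq zs k) ≤ Y := Real.sqrt_le_sqrt e2
  have s3 : √r ≤ X := Real.sqrt_le_sqrt (by linarith)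
  have s4 : √(run.energy zs (k + 1)) ≤ X := Real.sqrt_le_sqrt (by linarith)
  set q := C * (run.t k * ε k)
  have hq0 : 0 ≤ q := by positivity
  have hqk : q ≤ C * (k * ε k) :=
    mul_le_mul_of_nonneg_left (mul_le_mul_of_nonneg_right (run.t_le hk) hε) hC0
  have h1 : X ^ 2 ≤ Y ^ 2 + q * (2 * X + Y) := by
    have a1 := mul_le_mul_of_nonneg_left hbd (show 0 ≤ run.t k by linarith)
    have a2 := mul_le_mul_of_nonneg_left (add_le_add (add_le_add s1 s2) s3) hq0
    rw [hX, hY]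
    linarith
  -- completing the square
  have h2 : X - q ≤ Y + q := abs_le_of_sq_le_sq' (by nlinarith) (by linarith) |>.2
  linarith

theorem sqrt_energy_le (hD : D.IsAdmissible) {C : ℝ} (hC0 : 0 ≤ C) (hC : D.HasErrorBound C)
    (hε : ∀ k, 1 ≤ k → 0 ≤ ε k) (hsum : Summable fun k : ℕ => (k : ℝ) * ε k)
    {zs : DualVar N} (hzs : D.IsSolution zs) {k : ℕ} (hk : 1 ≤ k) :
    √(run.energy zs k) ≤ √(run.energy zs 1) + 2 * C * ∑' j : ℕ, (j : ℝ) * ε j := by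
  have h : √(run.energy zs k)
      ≤ √(run.energy zs 1) + 2 * C * ∑ j ∈ Finset.range k, (j : ℝ) * ε j := by
    induction k, hk using Nat.le_induction with
    | base => simp
    | succ k hk ih =>
      rw [Finset.sum_range_succ, mul_add]
      have := run.sqrt_energy_succ_le hD hC0 hC hzs hk
      linarith
  refine h.trans (add_le_add_right (mul_le_mul_of_nonneg_left ?_ (by positivity)) _)
  refine hsum.sum_le_tsum _ fun j _ => ?_
  rcases Nat.eq_zero_or_pos j with rfl | hj
  · simp
  · exact mul_nonneg (Nat.cast_nonneg _) (hε j hj)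

theorem objective_sub_le (hD : D.IsAdmissible) {C : ℝ} (hC0 : 0 ≤ C) (hC : D.HasErrorBound C)
    (hε : ∀ k, 1 ≤ k → 0 ≤ ε k) (hsum : Summable fun k : ℕ => (k : ℝ) * ε k)
    {zs : DualVar N} (hzs : D.IsSolution zs) {R B : ℝ} (hR : D.distSqS (run.zt 0) zs ≤ R)
    (hB : B = 2 * C * ∑' j : ℕ, (j : ℝ) * ε j) {k : ℕ} (hk : 1 ≤ k) :
    D.objective (run.zt k) - D.objective zs
      ≤ (2 * D.distSqS (run.zt 0) zs + 4 * (2 * B * √(R / 2) + B ^ 2)) / ((k : ℝ) + 1) ^ 2 := by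
  have hB0 : 0 ≤ B := by
    rw [hB]
    refine mul_nonneg (by positivity) (tsum_nonneg fun j => ?_)
    rcases Nat.eq_zero_or_pos j with rfl | hj
    · simp
    · exact mul_nonneg (Nat.cast_nonneg _) (hε j hj)
  have hmain := run.sqrt_energy_le hD hC0 hC hε hsum hzs (Nat.le_add_left 1 k)
  rw [← hB] at hmain
  have hE1 := run.dispSq_le_energy hD hzs le_rfl
  have hEk := run.dispSq_le_energy hD hzs (Nat.le_add_left 1 k)
  have d1 : 0 ≤ run.dispSq zs 1 := hD.normSqM_S_nonneg _
  have dk : 0 ≤ run.dispSq zs (k + 1) := hD.normSqM_S_nonneg _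
  have hsq1 := Real.sq_sqrt (show 0 ≤ run.energy zs 1 by linarith)
  have hsqk := Real.sq_sqrt (show 0 ≤ run.energy zs (k + 1) by linarith)
  have hRs : √(run.energy zs 1) ≤ √(R / 2) := by
    rw [energy_one]
    exact Real.sqrt_le_sqrt (by linarith)
  have h1 : run.energy zs (k + 1) ≤ run.energy zs 1 + 2 * B * √(R / 2) + B ^ 2 := by
    have a1 := pow_le_pow_left₀ (Real.sqrt_nonneg _) hmain 2
    have a2 := mul_le_mul_of_nonneg_left hRs hB0
    rw [hsqk] at a1
    linarith [add_sq (√(run.energy zs 1)) B]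
  have hΔ := sub_nonneg.2 (hzs.objective_le hD (run.lam_mem hD k))
  have h2 : run.t k ^ 2 * (D.objective (run.zt k) - D.objective zs) ≤ run.energy zs (k + 1) := by
    rw [energy, run.t_succ_sq_sub hk, Nat.add_sub_cancel]
    linarith
  have h3 : (((k : ℝ) + 1) / 2) ^ 2 * (D.objective (run.zt k) - D.objective zs)
      ≤ run.t k ^ 2 * (D.objective (run.zt k) - D.objective zs) :=
    mul_le_mul_of_nonneg_right (pow_le_pow_left₀ (by positivity) (run.t_ge hk) 2) hΔ
  rw [energy_one] at h1
  rw [le_div_iff₀ (by positivity)]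
  linarith

end Run

end DualData

/-! ### The discretized control problem -/

theorem Triangulation.dualData_isAdmissible {n : ℕ} (hn : n = 2 ∨ n = 3) (T : Triangulation n)
    {Ω : Set (EuclideanSpace ℝ (Fin n))} {A : EuclideanSpace ℝ (Fin n) → Matrix (Fin n) (Fin n) ℝ}
    {c : EuclideanSpace ℝ (Fin n) → ℝ} (hL : IsUniformlyElliptic Ω A c) {α β a b : ℝ} (hα : 0 < α)
    (hβ : 0 ≤ β) (hab : a ≤ b) (yd yr : Fin T.N → ℝ) :
    (T.dualData Ω A c α β a b yd yr).IsAdmissible where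
  mass_posDef := T.mass_posDef
  stiffness_isSymm := T.stiffness_isSymm hL.symm
  lumped_posDef := T.lumpedMass_posDef
  mass_le_lumped := T.normSqM_mass_le_lumpedMass
  lumped_le_mass x := by
    have h := T.normSqM_lumpedMass_le_mass x
    rcases hn with rfl | rfl <;> norm_num at h <;> simpa [dualData] using h
  cn_pos := by simp only [dualData]; split_ifs <;> norm_num
  α_pos := hα
  a_le_b := hab
  β_nonneg := hβ

theorem theorem5p3 {n : ℕ} (hn : n = 2 ∨ n = 3)
    -- the domain, the elliptic operator and the triangulation
    (Ω : Set (EuclideanSpace ℝ (Fin n))) (hΩ_open : IsOpen Ω) (hΩ_convex : Convex ℝ Ω)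
    (hΩ_bdd : Bornology.IsBounded Ω)
    (A : EuclideanSpace ℝ (Fin n) → Matrix (Fin n) (Fin n) ℝ) (c : EuclideanSpace ℝ (Fin n) → ℝ)
    (hL : IsUniformlyElliptic Ω A c)
    (T : Triangulation n) (hT : T.domain ⊆ Ω)
    (α : ℝ) (hα : 0 < α)
    -- the tolerances
    (ε : ℕ → ℝ) (hε : ∀ k, 1 ≤ k → 0 ≤ ε k) (hsum : Summable fun k : ℕ => (k : ℝ) * ε k)
    (R : ℝ) :
    ∃ c₀ : ℝ, 0 ≤ c₀ ∧
      ∀ (a b β : ℝ), a ≤ 0 → 0 ≤ b → 0 < β →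
      ∀ (fd fr : EuclideanSpace ℝ (Fin n) → ℝ),
        MemLp fd 2 (volume.restrict Ω) → MemLp fr 2 (volume.restrict Ω) →
      ∀ (yd yr : Fin T.N → ℝ), T.IsL2Projection Ω fd yd → T.IsL2Projection Ω fr yr →
      ∀ (zs : DualVar T.N), (T.dualData Ω A c α β a b yd yr).IsSolution zs →
      ∀ (run : (T.dualData Ω A c α β a b yd yr).Run ε),
        (T.dualData Ω A c α β a b yd yr).distSqS (run.zt 0) zs ≤ R →
      ∀ k : ℕ, 1 ≤ k →
        (T.dualData Ω A c α β a b yd yr).Phi (run.zt k) - (T.dualData Ω A c α β a b yd yr).Phi zs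
          ≤ (((2 * (T.dualData Ω A c α β a b yd yr).distSqS (run.zt 0) zs + c₀)
              / ((k : ℝ) + 1) ^ 2 : ℝ) : EReal) := by
  -- the error constant only involves the matrices and `α`, so it can be taken from trivial data
  obtain ⟨C, hC0, hC⟩ := (T.dualData_isAdmissible hn hL hα le_rfl (le_refl (0 : ℝ))
    0 0).exists_hasErrorBound
  have hT0 : 0 ≤ ∑' j : ℕ, (j : ℝ) * ε j := tsum_nonneg fun j => by
    rcases Nat.eq_zero_or_pos j with rfl | hj
    · simp
    · exact mul_nonneg (Nat.cast_nonneg _) (hε j hj)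
  refine ⟨4 * (2 * (2 * C * ∑' j : ℕ, (j : ℝ) * ε j) * √(R / 2)
    + (2 * C * ∑' j : ℕ, (j : ℝ) * ε j) ^ 2), by positivity, ?_⟩
  intro a b β ha hb hβ fd fr _ _ yd yr _ _ zs hzs run hR k hk
  have hD := T.dualData_isAdmissible (c := c) hn hL hα hβ.le (ha.trans hb) yd yr
  rw [DualData.Phi_of_mem (run.lam_mem hD k), DualData.Phi_of_mem (hzs.lam_mem hD),
    ← EReal.coe_sub, EReal.coe_le_coe_iff]
  exact run.objective_sub_le hD hC0 hC hε hsum hzs hR rfl hk
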